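/- Let $\epsilon\in\mathbb R^l$ and let $P_\epsilon$ be a local family of Poisson structures on $\mathbb R^3$, i.e. $P_\epsilon(x,y,z)$ is defined and $C^\infty$ in $(\epsilon,x,y,z)$ near $(0,0)\in\mathbb R^l\times\mathbb R^3$ and each $P_\epsilon$ is a Poisson structure. Put $P=P_0$ and assume that $P(0)=0$, that the 1-jet $j^1_0P$ is nonzero, and that $j^1_0P$ is not isomorphic, by a linear change of coordinates, to the linear Poisson structure $\{x,y\}=0,\ \{y,z\}=y,\ \{z,x\}=-x$. Two local families $P_\epsilon$, $\tilde P_\epsilon$ are called equivalent if there is a family of local diffeomorphisms $\phi_\epsilon$, smooth in $(\epsilon,x,y,z)$ near $(0,0)$, with $\phi_0(0)=0$ and $(\phi_\epsilon)_*P_\epsilon=\tilde P_\epsilon$ for all small $\epsilon$ (it is not required that $\phi_\epsilon(0)=0$ for $\epsilon\neq0$). Then: (a) $P_\epsilon$ is equivalent to a local family of Poisson structures of the form $$\{x,y\}=z,\quad \{y,z\}=U_\epsilon(x,y,z),\quad \{z,x\}=V_\epsilon(x,y,z).\qquad (*)$$ (b) For every local family of Poisson structures of the form $(*)$ equivalent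 to $P_\epsilon$ there is, for $\epsilon$ in a neighbourhood of $0$, a family of formal changes of the coordinates $x,y,z$ (formal power series whose coefficients depend smoothly on $\epsilon$), centred at the point $x=y=z=0$ for all $\epsilon$, which reduces the Taylor series of $(*)$ at $x=y=z=0$ to the form $$\{x,y\}=z,\quad \{y,z\}=\frac{\partial \hat f_\epsilon(x,y)}{\partial x}+z\,\frac{\partial \hat g_\epsilon(x,y)}{\partial x},\quad \{z,x\}=\frac{\partial \hat f_\epsilon(x,y)}{\partial y}+z\,\frac{\partial \hat g_\epsilon(x,y)}{\partial y},$$ where $\hat f_\epsilon,\hat g_\epsilon$ are formal power series in $x,y$ with coefficients depending smoothly on $\epsilon$, satisfying $\hat f_\epsilon(0)=\hat g_\epsilon(0)=0$ and $d\hat f_\epsilon\wedge d\hat g_\epsilon\equiv0$. -/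

import Mathlib

open Filter Topology
open scoped ContDiff Manifold

noncomputable section

namespace Poisson3

/-- Coordinate space `ℝ³`; the coordinates `x, y, z` have the indices `0, 1, 2`. -/
abbrev R3 : Type := Fin 3 → ℝ

/-- The parameter space `ℝ^l`. -/
abbrev Param (l : ℕ) : Type := Fin l → ℝ

/-- A field of 2-vectors on `ℝ³`, given by its components `π x i j = {x_i, x_j}(x)`.
Skew-symmetry is part of `IsPoissonAt`. -/
abbrev BivectorField : Type := R3 → Fin 3 → Fin 3 → ℝ

/-- A family of fields of 2-vectors, `P ε x i j = {x_i, x_j}_ε(x)`. Only the germ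
at `(ε, x) = (0, 0)` is ever used. -/
abbrev Family (l : ℕ) : Type := Param l → BivectorField

/-- The skew-symmetric array with `{x,y} = a`, `{y,z} = b`, `{z,x} = c`. -/
def skew {R : Type*} [Ring R] (a b c : R) : Fin 3 → Fin 3 → R :=
  ![![0, a, -c], ![-a, 0, b], ![c, -b, 0]]

/-- The partial derivative `∂f/∂x_i`. -/
def partialD (i : Fin 3) (f : R3 → ℝ) : R3 → ℝ :=
  fun x => fderiv ℝ f x (Pi.single i 1)

/-- The bracket `{f, g} = π(df, dg)` of two functions. -/
def bracket (π : BivectorField) (f g : R3 → ℝ) : R3 → ℝ :=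
  fun x => ∑ i, ∑ j, π x i j * partialD i f x * partialD j g x

/-- Near the point `x` the bracket of `π` makes the smooth functions a Lie algebra:
it is skew-symmetric at `x`, and the Jacobi identity holds at `x` for all germs of smooth functions.
(The Leibniz rule and bilinearity hold for every bracket given by a 2-vector.) -/
def IsPoissonAt (π : BivectorField) (x : R3) : Prop :=
  (∀ i j, π x i j = -π x j i) ∧
  ∀ f g h : R3 → ℝ, ContDiffAt ℝ ∞ f x → ContDiffAt ℝ ∞ g x → ContDiffAt ℝ ∞ h x →
    bracket π f (bracket π g h) x + bracket π g (bracket π h f) x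
      + bracket π h (bracket π f g) x = 0

/-- A local family of Poisson structures on `ℝ³`: in a neighbourhood of `(0, 0)` in
`ℝ^l × ℝ³` it depends smoothly on `(ε, x)`, and each `P ε` is a Poisson structure. -/
def IsLocalPoissonFamily {l : ℕ} (P : Family l) : Prop :=
  ∃ U : Set (Param l × R3), IsOpen U ∧ (0, 0) ∈ U ∧
    ContDiffOn ℝ ∞ (fun p : Param l × R3 => P p.1 p.2) U ∧
    ∀ p ∈ U, IsPoissonAt (P p.1) p.2

/-- The map `φ` sends the 2-vector of `π` at `x` to the 2-vector of `π'` at `φ x`: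
in the coordinates `X_i = φ_i(x)` the brackets are `{X_i, X_j} = π' i j`. -/
def SendsAt (φ : R3 → R3) (π π' : BivectorField) (x : R3) : Prop :=
  ∀ i j, bracket π (fun y => φ y i) (fun y => φ y j) x = π' (φ x) i j

/-- Equivalence of local families: there is a smooth family `φ ε` of local diffeomorphisms
with `φ 0 0 = 0` (but possibly `φ ε 0 ≠ 0` for `ε ≠ 0`) and `(φ ε)_* (P ε) = Q ε`. That `φ` is a
smooth family of local diffeomorphisms (defined on a common neighbourhood, with smooth family of
inverses) is the statement that `(ε, x) ↦ (ε, φ ε x)` is a local diffeomorphism at `(0, 0)`. -/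
def FamilyEquiv {l : ℕ} (P Q : Family l) : Prop :=
  ∃ φ : Param l → R3 → R3, φ 0 0 = 0 ∧
    IsLocalDiffeomorphAt 𝓘(ℝ, Param l × R3) 𝓘(ℝ, Param l × R3) ∞
      (fun p : Param l × R3 => (p.1, φ p.1 p.2)) (0, 0) ∧
    ∀ᶠ p : Param l × R3 in 𝓝 (0, 0), SendsAt (φ p.1) (P p.1) (Q p.1) p.2

/-- The 1-jet at the origin, as the Taylor polynomial of degree one. -/
def oneJet (π : BivectorField) : BivectorField :=
  fun x => π 0 + fderiv ℝ π 0 x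

/-- Isomorphism of linear Poisson structures, i.e. of the corresponding Lie algebras:
a linear change of coordinates takes one to the other. -/
def LinearlyIsomorphic (π π' : BivectorField) : Prop :=
  ∃ A : R3 ≃ₗ[ℝ] R3, ∀ x, SendsAt A π π' x

/-- The linear Poisson structure `{x,y} = 0`, `{y,z} = y`, `{z,x} = -x`. -/
def exceptional : BivectorField := fun x => skew 0 (x 1) (-x 0)

/-- The families of the form `{x,y} = z`, `{y,z} = U_ε(x,y,z)`, `{z,x} = V_ε(x,y,z)`. -/
def HasPreNormalForm {l : ℕ} (Q : Family l) : Prop :=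
  ∃ U V : Param l → R3 → ℝ, ∀ᶠ p : Param l × R3 in 𝓝 (0, 0),
    Q p.1 p.2 = skew (p.2 2) (U p.1 p.2) (V p.1 p.2)

/-- Formal power series in `x, y, z`. -/
abbrev Series3 : Type := MvPowerSeries (Fin 3) ℝ

/-- Formal power series in `x, y`. -/
abbrev Series2 : Type := MvPowerSeries (Fin 2) ℝ

/-- The Taylor series at the origin of a smooth function. -/
def taylor (f : R3 → ℝ) : Series3 := fun n =>
  ((partialD 0)^[n 0] ((partialD 1)^[n 1] ((partialD 2)^[n 2] f))) 0
    / ((n 0).factorial * (n 1).factorial * (n 2).factorial : ℝ)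

/-- The formal bracket of two series, for a formal field of 2-vectors `π`. -/
def formalBracket (π : Fin 3 → Fin 3 → Series3) (f g : Series3) : Series3 :=
  ∑ i, ∑ j, π i j * MvPowerSeries.pderiv ℝ i f * MvPowerSeries.pderiv ℝ j g

/-- A formal change of coordinates centred at the origin: `φ(0) = 0` and the linear part of `φ`
is invertible. -/
def IsFormalChange (φ : Fin 3 → Series3) : Prop :=
  (∀ i, MvPowerSeries.constantCoeff (φ i) = 0) ∧
  IsUnit (Matrix.of fun i j : Fin 3 => MvPowerSeries.coeff (Finsupp.single j 1) (φ i)).det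

/-- The formal change `φ` reduces `π` to `π'`: in the new coordinates `X_i = φ_i` one has
`{X_i, X_j} = π' i j (X)`. -/
def FormallySends (φ : Fin 3 → Series3) (π π' : Fin 3 → Fin 3 → Series3) : Prop :=
  ∀ i j, formalBracket π (φ i) (φ j) = MvPowerSeries.subst φ (π' i j)

/-- A series depending on a parameter is smooth on `W` if each of its coefficients is. -/
def SmoothSeriesOn {l : ℕ} {σ : Type*} (W : Set (Param l)) (f : Param l → MvPowerSeries σ ℝ) :
    Prop :=
  ∀ n : σ →₀ ℕ, ContDiffOn ℝ ∞ (fun ε => MvPowerSeries.coeff n (f ε)) W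

/-- A series in `x, y` regarded as a series in `x, y, z`. -/
def incl (f : Series2) : Series3 := MvPowerSeries.rename (Fin.castSucc : Fin 2 → Fin 3) f

/-- The formal 2-vector `{x,y} = z`, `{y,z} = ∂f/∂x + z ∂g/∂x`, `{z,x} = ∂f/∂y + z ∂g/∂y`. -/
def normalForm (f g : Series2) : Fin 3 → Fin 3 → Series3 :=
  skew (MvPowerSeries.X 2)
    (incl (MvPowerSeries.pderiv ℝ 0 f) + MvPowerSeries.X 2 * incl (MvPowerSeries.pderiv ℝ 0 g))
    (incl (MvPowerSeries.pderiv ℝ 1 f) + MvPowerSeries.X 2 * incl (MvPowerSeries.pderiv ℝ 1 g))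

/-- A smooth family of formal changes of coordinates, centred at the origin for every `ε`,
reduces (the Taylor series of) the family `Q` to the normal form, with `f_ε(0) = g_ε(0) = 0` and
`df_ε ∧ dg_ε = 0`. -/
def FormallyReducible {l : ℕ} (Q : Family l) : Prop :=
  ∃ W : Set (Param l), IsOpen W ∧ 0 ∈ W ∧
  ∃ (φ : Param l → Fin 3 → Series3) (f g : Param l → Series2),
    (∀ i, SmoothSeriesOn W fun ε => φ ε i) ∧ SmoothSeriesOn W f ∧ SmoothSeriesOn W g ∧
    ∀ ε ∈ W,
      IsFormalChange (φ ε) ∧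
      FormallySends (φ ε) (fun i j => taylor fun x => Q ε x i j) (normalForm (f ε) (g ε)) ∧
      MvPowerSeries.constantCoeff (f ε) = 0 ∧ MvPowerSeries.constantCoeff (g ε) = 0 ∧
      MvPowerSeries.pderiv ℝ 0 (f ε) * MvPowerSeries.pderiv ℝ 1 (g ε)
        - MvPowerSeries.pderiv ℝ 1 (f ε) * MvPowerSeries.pderiv ℝ 0 (g ε) = 0

end Poisson3

end

/-!
For a field of 2-vectors `{x,y} = z`, `{y,z} = U`, `{z,x} = V` the Jacobi identity is the single
equation `z (U_y - V_x) + U V_z - V U_z = 0`.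

*Pre-normal form.* In a three-dimensional skew algebra that is neither zero nor exceptional, some
`u, v, [u,v]` form a basis (`exists_det_ne_zero`): if `u, v, [u,v]` are always dependent, then
`[u,v] = α(u) v - α(v) u`, and `α ≠ 0` gives the exceptional algebra. Regarding `u, v` as linear
functions on `ℝ³`, the functions `u, v, {u,v}_ε` are then coordinates near the origin by the inverse
function theorem, and in these coordinates `{x,y} = z` (`exists_preNormalForm`).

*Formal normal form.* Only the form `{x,y} = z` and the Jacobi identity are needed. The coordinate
`x` is kept, `y` is replaced by a series `Y`, and `z` by `Z = {x,Y}`. What has to be found is a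
series `N = f(x,y) + z g(x,y)` with `{Y,Z} = N_x(x,Y,Z)` and `{Z,x} = N_y(x,Y,Z)`. Give `x, y, z`
the weights `3, 3, 1`. Then `{x,y} = z` is the term of the bracket that lowers the weight most, even
when `U` and `V` have constant terms, which for `ε ≠ 0` cannot be excluded. If both equations hold
up to defects `e₁, e₂` of weight at least `m`, the leading part of the Jacobi identity for `x, Y, Z`
says that `e₁ dx + e₂ dy` is closed, hence equal to `H_x dx + H_y dy`, up to higher weight
(`pderiv_defectX_sub_pderiv_defectY_mem`). Write `H = L + z² K` with `L` affine in `z`: adding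
`L` to `N` and `∫ K dy` to `Y` raises the weight of the defects (`exists_correction`). In the limit
the defects vanish, and the Jacobi identity becomes `df ∧ dg = 0` (`exists_normalisation`).

*Dependence on the parameter.* The formal argument works over every commutative `ℝ`-algebra of
coefficients. Applied to the algebra of functions that are smooth on an open set of parameters, it
yields families of series with smooth coefficients (`exists_formal_reduction`).
-/

/-! ### The weight filtration on formal power series -/

namespace Poisson3

open MvPowerSeries

section Weight

variable {R : Type*} [CommRing R]

/-- The weight of the monomial `x^a y^b z^c`, with `x` and `y` of weight `3` and `z` of weight
`1`. -/
def wt (d : Fin 3 →₀ ℕ) : ℕ := 3 * d 0 + 3 * d 1 + d 2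

/-- The weights `3, 3, 1` of the variables `x, y, z`. -/
def varWt : Fin 3 → ℕ := ![3, 3, 1]

lemma wt_add (d e : Fin 3 →₀ ℕ) : wt (d + e) = wt d + wt e := by
  simp only [wt, Finsupp.add_apply]; ring

lemma wt_single (i : Fin 3) (k : ℕ) : wt (Finsupp.single i k) = k * varWt i := by
  fin_cases i <;> simp [wt, varWt, mul_comm]

variable (R) in
/-- The ideal of the series all of whose monomials have weight at least `n`. -/
def wtIdeal (n : ℕ) : Ideal (MvPowerSeries (Fin 3) R) where
  carrier := {f | ∀ d, wt d < n → coeff d f = 0}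
  add_mem' hf hg d hd := by rw [map_add, hf d hd, hg d hd, add_zero]
  zero_mem' d _ := map_zero _
  smul_mem' c f hf d hd := by
    rw [smul_eq_mul, coeff_mul]
    refine Finset.sum_eq_zero fun p hp => ?_
    rw [Finset.HasAntidiagonal.mem_antidiagonal] at hp
    rw [hf p.2 (by rw [← hp, wt_add] at hd; omega), mul_zero]

lemma wtIdeal_anti {m n : ℕ} (h : m ≤ n) {f : MvPowerSeries (Fin 3) R} (hf : f ∈ wtIdeal R n) :
    f ∈ wtIdeal R m := fun d hd => hf d (hd.trans_le h)

lemma mem_wtIdeal_zero (f : MvPowerSeries (Fin 3) R) : f ∈ wtIdeal R 0 :=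
  fun _ hd => absurd hd (Nat.not_lt_zero _)

lemma mul_mem_wtIdeal {m n : ℕ} {f g : MvPowerSeries (Fin 3) R} (hf : f ∈ wtIdeal R m)
    (hg : g ∈ wtIdeal R n) : f * g ∈ wtIdeal R (m + n) := by
  intro d hd
  rw [coeff_mul]
  refine Finset.sum_eq_zero fun p hp => ?_
  rw [Finset.HasAntidiagonal.mem_antidiagonal] at hp
  rw [← hp, wt_add] at hd
  rcases lt_or_ge (wt p.1) m with h | h
  · rw [hf _ h, zero_mul]
  · rw [hg _ (by omega), mul_zero]

lemma mul_mem_wtIdeal_of_le {k m n : ℕ} (h : k ≤ m + n) {f g : MvPowerSeries (Fin 3) R}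
    (hf : f ∈ wtIdeal R m) (hg : g ∈ wtIdeal R n) : f * g ∈ wtIdeal R k :=
  wtIdeal_anti h (mul_mem_wtIdeal hf hg)

lemma pow_mem_wtIdeal {n : ℕ} {f : MvPowerSeries (Fin 3) R} (hf : f ∈ wtIdeal R n) (k : ℕ) :
    f ^ k ∈ wtIdeal R (k * n) := by
  induction k with
  | zero => simpa using mem_wtIdeal_zero (R := R) 1
  | succ k ih =>
    rw [pow_succ, Nat.succ_mul]
    exact mul_mem_wtIdeal ih hf

lemma eq_zero_of_forall_mem_wtIdeal {f : MvPowerSeries (Fin 3) R}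
    (hf : ∀ n, f ∈ wtIdeal R n) : f = 0 :=
  ext fun d => hf (wt d + 1) d (Nat.lt_succ_self _)

lemma X_mem_wtIdeal (i : Fin 3) : (X i : MvPowerSeries (Fin 3) R) ∈ wtIdeal R (varWt i) := by
  intro d hd
  rw [coeff_X, if_neg]
  rintro rfl
  rw [wt_single] at hd
  omega

lemma pderiv_mem_wtIdeal {n : ℕ} (i : Fin 3) {f : MvPowerSeries (Fin 3) R}
    (hf : f ∈ wtIdeal R n) : pderiv R i f ∈ wtIdeal R (n - varWt i) := by
  intro d hd
  rw [coeff_pderiv, hf, zero_mul]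
  rw [wt_add, wt_single]
  omega

lemma pderiv_mem_wtIdeal_of_le {k n : ℕ} (i : Fin 3) (h : k + varWt i ≤ n)
    {f : MvPowerSeries (Fin 3) R} (hf : f ∈ wtIdeal R n) : pderiv R i f ∈ wtIdeal R k :=
  wtIdeal_anti (by omega) (pderiv_mem_wtIdeal i hf)

lemma constantCoeff_eq_zero_of_mem_wtIdeal {n : ℕ} (hn : 0 < n) {f : MvPowerSeries (Fin 3) R}
    (hf : f ∈ wtIdeal R n) : constantCoeff f = 0 := by
  rw [← coeff_zero_eq_constantCoeff_apply]
  exact hf 0 (by simpa [wt] using hn)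

lemma pderiv_comm (i j : Fin 3) (f : MvPowerSeries (Fin 3) R) :
    pderiv R i (pderiv R j f) = pderiv R j (pderiv R i f) := by
  rcases eq_or_ne i j with rfl | hij
  · rfl
  ext d
  simp only [coeff_pderiv, Finsupp.add_apply, Finsupp.single_eq_of_ne hij,
    Finsupp.single_eq_of_ne hij.symm, add_zero, add_right_comm d]
  ring

end Weight

section Integration

variable {R : Type*} [CommRing R] [Algebra ℝ R]

/-- A series with prescribed `y`-derivative `q`, whose `x`-derivative agrees with `p` on `y = 0`.
If the form `p dx + q dy` is closed, this is a primitive of it. -/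
noncomputable def potential (p q : MvPowerSeries (Fin 3) R) : MvPowerSeries (Fin 3) R := fun d =>
  if d 1 ≠ 0 then ((d 1 : ℝ)⁻¹) • coeff (d - Finsupp.single 1 1) q
  else if d 0 ≠ 0 then ((d 0 : ℝ)⁻¹) • coeff (d - Finsupp.single 0 1) p else 0

lemma coeff_potential (p q : MvPowerSeries (Fin 3) R) (d : Fin 3 →₀ ℕ) :
    coeff d (potential p q) =
      if d 1 ≠ 0 then ((d 1 : ℝ)⁻¹) • coeff (d - Finsupp.single 1 1) q
      else if d 0 ≠ 0 then ((d 0 : ℝ)⁻¹) • coeff (d - Finsupp.single 0 1) p else 0 := rfl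

lemma smul_mul_natCast_succ (k : ℕ) (r : R) : (((k + 1 : ℕ) : ℝ)⁻¹ • r) * ((k : R) + 1) = r := by
  have h : ((k : R) + 1) = algebraMap ℝ R ((k + 1 : ℕ) : ℝ) := by simp
  rw [h, mul_comm, ← Algebra.smul_def, smul_smul, mul_inv_cancel₀ (by positivity), one_smul]

lemma pderiv_one_potential (p q : MvPowerSeries (Fin 3) R) :
    pderiv R 1 (potential p q) = q := by
  ext d
  rw [coeff_pderiv, coeff_potential, if_pos (by simp)]
  simpa using smul_mul_natCast_succ (d 1) (coeff d q)

lemma pderiv_zero_potential_sub_mem {k : ℕ} {p q : MvPowerSeries (Fin 3) R}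
    (h : pderiv R 1 p - pderiv R 0 q ∈ wtIdeal R k) :
    pderiv R 0 (potential p q) - p ∈ wtIdeal R (k + 3) := by
  intro d hd
  rw [map_sub, coeff_pderiv, coeff_potential]
  rcases Nat.eq_zero_or_pos (d 1) with h1 | h1
  · rw [if_neg (by simp [h1]), if_pos (by simp), sub_eq_zero]
    simpa using smul_mul_natCast_succ (d 0) (coeff d p)
  · obtain ⟨e, rfl⟩ : ∃ e, d = e + Finsupp.single 1 1 :=
      ⟨d - Finsupp.single 1 1,
        (tsub_add_cancel_of_le (by simpa [Nat.one_le_iff_ne_zero] using h1.ne')).symm⟩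
    have he := h e (by simp only [wt_add, wt_single, varWt] at hd; simpa using hd)
    rw [map_sub, coeff_pderiv, coeff_pderiv, sub_eq_zero] at he
    rw [if_pos (by simp), add_right_comm, add_tsub_cancel_right, sub_eq_zero, smul_mul_assoc]
    simp only [Finsupp.add_apply, Finsupp.single_apply, Fin.isValue, one_ne_zero, if_false,
      add_zero, zero_ne_one, if_true]
    rw [← he, ← smul_mul_assoc]
    exact smul_mul_natCast_succ _ _

lemma potential_mem_wtIdeal {m : ℕ} {p q : MvPowerSeries (Fin 3) R} (hp : p ∈ wtIdeal R m)
    (hq : q ∈ wtIdeal R m) : potential p q ∈ wtIdeal R (m + 3) := by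
  intro d hd
  rw [coeff_potential]
  split_ifs with h1 h0
  · rw [hq, smul_zero]
    simp [wt] at hd ⊢
    omega
  · rw [hp, smul_zero]
    simp [wt] at hd h1 ⊢
    omega
  · rfl

end Integration

section Affine

variable {R : Type*} [CommRing R]

/-- The part of a series that is of degree at most one in `z`. -/
def affinePart (f : MvPowerSeries (Fin 3) R) : MvPowerSeries (Fin 3) R :=
  fun d => if d 2 ≤ 1 then coeff d f else 0

/-- The quotient by `z²` of the terms of degree at least two in `z`. -/
noncomputable def quadraticPart (f : MvPowerSeries (Fin 3) R) : MvPowerSeries (Fin 3) R :=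
  fun d => coeff (d + Finsupp.single 2 2) f

lemma coeff_affinePart (f : MvPowerSeries (Fin 3) R) (d : Fin 3 →₀ ℕ) :
    coeff d (affinePart f) = if d 2 ≤ 1 then coeff d f else 0 := rfl

lemma coeff_quadraticPart (f : MvPowerSeries (Fin 3) R) (d : Fin 3 →₀ ℕ) :
    coeff d (quadraticPart f) = coeff (d + Finsupp.single 2 2) f := rfl

lemma coeff_X_pow_mul_of_lt (f : MvPowerSeries (Fin 3) R) {k : ℕ} {d : Fin 3 →₀ ℕ}
    (h : d 2 < k) : coeff d (X 2 ^ k * f) = 0 := by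
  classical
  rw [X_pow_eq, coeff_monomial_mul, if_neg]
  intro hle
  have := hle 2
  simp at this
  omega

lemma coeff_add_X_pow_mul (f : MvPowerSeries (Fin 3) R) (k : ℕ) (d : Fin 3 →₀ ℕ) :
    coeff (d + Finsupp.single 2 k) (X 2 ^ k * f) = coeff d f := by
  rw [X_pow_eq, add_comm, coeff_add_monomial_mul, one_mul]

lemma affinePart_add_quadraticPart (f : MvPowerSeries (Fin 3) R) :
    affinePart f + X 2 ^ 2 * quadraticPart f = f := by
  ext d
  rw [map_add, coeff_affinePart]
  split_ifs with h
  · rw [coeff_X_pow_mul_of_lt _ (by omega), add_zero]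
  · obtain ⟨e, rfl⟩ : ∃ e, d = e + Finsupp.single 2 2 :=
      ⟨d - Finsupp.single 2 2, (tsub_add_cancel_of_le (by simp; omega)).symm⟩
    rw [coeff_add_X_pow_mul, coeff_quadraticPart, zero_add]

lemma affinePart_mem_wtIdeal {n : ℕ} {f : MvPowerSeries (Fin 3) R} (hf : f ∈ wtIdeal R n) :
    affinePart f ∈ wtIdeal R n := by
  intro d hd
  rw [coeff_affinePart, hf d hd, ite_self]

lemma quadraticPart_mem_wtIdeal {n : ℕ} {f : MvPowerSeries (Fin 3) R}
    (hf : f ∈ wtIdeal R (n + 2)) : quadraticPart f ∈ wtIdeal R n := by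
  intro d hd
  rw [coeff_quadraticPart, hf]
  rw [wt_add, wt_single]
  simpa [varWt] using hd

lemma pderiv_two_pderiv_two_affinePart (f : MvPowerSeries (Fin 3) R) :
    pderiv R 2 (pderiv R 2 (affinePart f)) = 0 := by
  ext d
  rw [coeff_pderiv, coeff_pderiv, coeff_affinePart, if_neg (by simp), zero_mul, zero_mul, map_zero]

variable [Algebra ℝ R]

lemma coeff_eq_zero_of_pderiv_two {h : MvPowerSeries (Fin 3) R} (hh : pderiv R 2 h = 0)
    (d : Fin 3 →₀ ℕ) : coeff (d + Finsupp.single 2 1) h = 0 := by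
  have := congrArg (coeff d) hh
  rw [coeff_pderiv, map_zero] at this
  have h' := smul_mul_natCast_succ (d 2) (coeff (d + Finsupp.single 2 1) h)
  rw [smul_mul_assoc, this, smul_zero] at h'
  exact h'.symm

/-- The terms of a sum `z f + h` with `h` independent of `z` do not interfere. -/
lemma mem_wtIdeal_of_X_mul_add {n : ℕ} {f h : MvPowerSeries (Fin 3) R}
    (hh : pderiv R 2 h = 0) (hf : X 2 * f + h ∈ wtIdeal R (n + 1)) : f ∈ wtIdeal R n := by
  intro d hd
  have := hf (d + Finsupp.single 2 1) (by rw [wt_add, wt_single]; simpa [varWt] using hd)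
  rw [map_add, coeff_eq_zero_of_pderiv_two hh, add_zero] at this
  rw [← this]
  simpa using (coeff_add_X_pow_mul f 1 d).symm

end Affine

end Poisson3

/-! ### Substitution, the weight filtration and the chain rule -/

namespace Poisson3

open MvPowerSeries

section Substitution

variable {R : Type*} [CommRing R] {a b : Fin 3 → MvPowerSeries (Fin 3) R}

lemma hasSubst_of_mem_wtIdeal (ha : ∀ i, a i ∈ wtIdeal R (varWt i)) : HasSubst a :=
  hasSubst_of_constantCoeff_zero fun i =>
    constantCoeff_eq_zero_of_mem_wtIdeal (by fin_cases i <;> simp [varWt]) (ha i)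

lemma subst_sub_subst_mem {n : ℕ} (ha : HasSubst a) (hb : HasSubst b)
    (p : MvPowerSeries (Fin 3) R)
    (h : ∀ d, coeff d p ≠ 0 → (a 0 ^ d 0 * a 1 ^ d 1 * a 2 ^ d 2)
      - (b 0 ^ d 0 * b 1 ^ d 1 * b 2 ^ d 2) ∈ wtIdeal R n) :
    subst a p - subst b p ∈ wtIdeal R n := by
  intro e he
  rw [map_sub, coeff_subst ha, coeff_subst hb, ← finsum_sub_distrib (coeff_subst_finite ha p e)
    (coeff_subst_finite hb p e)]
  refine finsum_eq_zero_of_forall_eq_zero fun d => ?_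
  by_cases hd : coeff d p = 0
  · simp [hd]
  · have := h d hd e he
    rw [map_sub, sub_eq_zero] at this
    simp [Finsupp.prod_fintype, Fin.prod_univ_three, this]

lemma monomial_mem_wtIdeal (ha : ∀ i, a i ∈ wtIdeal R (varWt i)) (d : Fin 3 →₀ ℕ) :
    a 0 ^ d 0 * a 1 ^ d 1 * a 2 ^ d 2 ∈ wtIdeal R (wt d) := by
  have := mul_mem_wtIdeal (mul_mem_wtIdeal (pow_mem_wtIdeal (ha 0) (d 0))
    (pow_mem_wtIdeal (ha 1) (d 1))) (pow_mem_wtIdeal (ha 2) (d 2))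
  refine wtIdeal_anti ?_ this
  simp [wt, varWt, mul_comm]

lemma subst_mem_wtIdeal {n : ℕ} (ha : ∀ i, a i ∈ wtIdeal R (varWt i))
    {p : MvPowerSeries (Fin 3) R} (hp : p ∈ wtIdeal R n) : subst a p ∈ wtIdeal R n := by
  intro e he
  rw [coeff_subst (hasSubst_of_mem_wtIdeal ha)]
  refine finsum_eq_zero_of_forall_eq_zero fun d => ?_
  rcases lt_or_ge (wt d) n with h | h
  · simp [hp d h]
  · have := wtIdeal_anti h (monomial_mem_wtIdeal ha d) e he
    simp [Finsupp.prod_fintype, Fin.prod_univ_three, this]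

lemma subst_sub_subst_mem_of_sub_mem {n : ℕ} (ha : HasSubst a) (hb : HasSubst b)
    (h : ∀ i, a i - b i ∈ wtIdeal R n) (p : MvPowerSeries (Fin 3) R) :
    subst a p - subst b p ∈ wtIdeal R n := by
  refine subst_sub_subst_mem ha hb p fun d _ => ?_
  rw [← Ideal.Quotient.mk_eq_mk_iff_sub_mem]
  have h' : ∀ i, Ideal.Quotient.mk (wtIdeal R n) (a i) = Ideal.Quotient.mk (wtIdeal R n) (b i) :=
    fun i => (Ideal.Quotient.mk_eq_mk_iff_sub_mem _ _).2 (h i)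
  simp only [map_mul, map_pow, h']

lemma mul_sub_mul_mem_wtIdeal {m n k : ℕ} {f f' g g' : MvPowerSeries (Fin 3) R} (hk : k = m + n)
    (hf : f ∈ wtIdeal R m) (hg' : g' ∈ wtIdeal R n)
    (hff : f - f' ∈ wtIdeal R (m + 1)) (hgg : g - g' ∈ wtIdeal R (n + 1)) :
    f * g - f' * g' ∈ wtIdeal R (k + 1) := by
  subst hk
  have h1 := mul_mem_wtIdeal hf hgg
  have h2 := mul_mem_wtIdeal hff hg'
  rw [show m + 1 + n = m + n + 1 by ring] at h2
  rw [show f * g - f' * g' = f * (g - g') + (f - f') * g' by ring]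
  exact add_mem h1 h2

lemma pow_sub_pow_mem_wtIdeal {m : ℕ} {f f' : MvPowerSeries (Fin 3) R}
    (hf : f ∈ wtIdeal R m) (hf' : f' ∈ wtIdeal R m) (hff : f - f' ∈ wtIdeal R (m + 1)) (k : ℕ) :
    f ^ k - f' ^ k ∈ wtIdeal R (k * m + 1) := by
  induction k with
  | zero => simp
  | succ k ih =>
    rw [pow_succ, pow_succ]
    exact mul_sub_mul_mem_wtIdeal (Nat.succ_mul k m) (pow_mem_wtIdeal hf k) hf' ih hff

/-- A substitution that is the identity up to terms of higher weight does not change the leading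
terms of a series. -/
lemma subst_sub_self_mem {n : ℕ} (ha : ∀ i, a i - X i ∈ wtIdeal R (varWt i + 1))
    {p : MvPowerSeries (Fin 3) R} (hp : p ∈ wtIdeal R n) : subst a p - p ∈ wtIdeal R (n + 1) := by
  have hX := X_mem_wtIdeal (R := R)
  have ha' : ∀ i, a i ∈ wtIdeal R (varWt i) := fun i => by
    simpa using add_mem (wtIdeal_anti (Nat.le_succ _) (ha i)) (hX i)
  have key := subst_sub_subst_mem (n := n + 1) (hasSubst_of_mem_wtIdeal ha') HasSubst.X p ?_
  · rwa [show subst (fun i => (X i : MvPowerSeries (Fin 3) R)) p = p from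
      congrFun subst_self p] at key
  · intro d hd
    have hn : n ≤ wt d := not_lt.1 fun h => hd (hp d h)
    have h01 := mul_sub_mul_mem_wtIdeal rfl (pow_mem_wtIdeal (ha' 0) (d 0))
      (pow_mem_wtIdeal (hX 1) (d 1)) (pow_sub_pow_mem_wtIdeal (ha' 0) (hX 0) (ha 0) (d 0))
      (pow_sub_pow_mem_wtIdeal (ha' 1) (hX 1) (ha 1) (d 1))
    have h012 := mul_sub_mul_mem_wtIdeal rfl
      (mul_mem_wtIdeal (pow_mem_wtIdeal (ha' 0) (d 0)) (pow_mem_wtIdeal (ha' 1) (d 1)))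
      (pow_mem_wtIdeal (hX 2) (d 2)) h01
      (pow_sub_pow_mem_wtIdeal (ha' 2) (hX 2) (ha 2) (d 2))
    refine wtIdeal_anti ?_ h012
    simp only [wt, varWt] at hn ⊢
    simp
    omega

lemma eq_zero_of_subst_eq_zero (ha : ∀ i, a i - X i ∈ wtIdeal R (varWt i + 1))
    {p : MvPowerSeries (Fin 3) R} (hp : subst a p = 0) : p = 0 := by
  refine eq_zero_of_forall_mem_wtIdeal fun n => ?_
  induction n with
  | zero => exact mem_wtIdeal_zero p
  | succ n ih => simpa [hp] using subst_sub_self_mem ha ih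

lemma pderiv_subst_coe (ha : HasSubst a) (i : Fin 3) (p : MvPolynomial (Fin 3) R) :
    pderiv R i (subst a (p : MvPowerSeries (Fin 3) R)) =
      ∑ j, subst a (pderiv R j (p : MvPowerSeries (Fin 3) R)) * pderiv R i (a j) := by
  simp only [pderiv_coe]
  rw [← coe_substAlgHom ha]
  simp only [substAlgHom_coe]
  induction p using MvPolynomial.induction_on with
  | C r => simp [← MvPowerSeries.c_eq_algebraMap]
  | add p q hp hq => simp [hp, hq, add_mul, Finset.sum_add_distrib]
  | mul_X p k hp =>
    simp only [map_mul, MvPolynomial.aeval_X, Derivation.leibniz, smul_eq_mul, hp, map_add,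
      MvPolynomial.pderiv_X, add_mul, Finset.sum_add_distrib, Finset.mul_sum]
    congr 1
    · rw [Finset.sum_eq_single k]
      · simp
      · intro j _ hj
        simp [hj.symm]
      · simp
    · exact Finset.sum_congr rfl fun j _ => by ring

/-- Every series is a polynomial up to terms of high weight. -/
lemma exists_sub_coe_mem_wtIdeal (n : ℕ) (p : MvPowerSeries (Fin 3) R) :
    ∃ q : MvPolynomial (Fin 3) R, p - q ∈ wtIdeal R n := by
  refine ⟨trunc R (Finsupp.equivFunOnFinite.symm fun _ => n + 1) p, fun d hd => ?_⟩
  rw [map_sub, MvPolynomial.coeff_coe, coeff_trunc, if_pos, sub_self]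
  rw [Finsupp.lt_def]
  refine ⟨fun i => ?_, 0, ?_⟩
  · simp only [wt] at hd
    simp only [Finsupp.equivFunOnFinite_symm_apply_apply]
    fin_cases i <;> simp <;> omega
  · simp only [wt] at hd
    simp only [Finsupp.equivFunOnFinite_symm_apply_apply]
    omega

/-- The chain rule for partial derivatives. -/
lemma pderiv_subst (ha : ∀ i, a i ∈ wtIdeal R (varWt i)) (i : Fin 3)
    (p : MvPowerSeries (Fin 3) R) :
    pderiv R i (subst a p) = ∑ j, subst a (pderiv R j p) * pderiv R i (a j) := by
  have hs := hasSubst_of_mem_wtIdeal ha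
  rw [← sub_eq_zero]
  refine eq_zero_of_forall_mem_wtIdeal fun n => ?_
  obtain ⟨q, hq⟩ := exists_sub_coe_mem_wtIdeal (n + 3) p
  obtain ⟨r, rfl⟩ : ∃ r, p = q + r := ⟨p - q, by ring⟩
  rw [add_sub_cancel_left] at hq
  have hw : ∀ j, varWt j ≤ 3 := by decide
  have h1 : pderiv R i (subst a r) ∈ wtIdeal R n :=
    pderiv_mem_wtIdeal_of_le i (by have := hw i; omega) (subst_mem_wtIdeal ha hq)
  have h2 : ∑ j, subst a (pderiv R j r) * pderiv R i (a j) ∈ wtIdeal R n :=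
    sum_mem fun j _ => Ideal.mul_mem_right _ _ (subst_mem_wtIdeal ha
      (pderiv_mem_wtIdeal_of_le j (by have := hw j; omega) hq))
  simp only [map_add, subst_add hs, add_mul, Finset.sum_add_distrib, pderiv_subst_coe hs]
  rw [add_sub_add_left_eq_sub]
  exact sub_mem h1 h2

end Substitution

end Poisson3

/-! ### Successive approximation of the normalising change of coordinates -/

namespace Poisson3

open MvPowerSeries

section Bracket

variable {R : Type*} [CommRing R] {U V : MvPowerSeries (Fin 3) R}

/-- The bracket of two series for the formal 2-vector `{x,y} = z`, `{y,z} = U`, `{z,x} = V`. -/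
noncomputable def seriesBracket (U V f g : MvPowerSeries (Fin 3) R) : MvPowerSeries (Fin 3) R :=
  X 2 * (pderiv R 0 f * pderiv R 1 g - pderiv R 1 f * pderiv R 0 g)
    + U * (pderiv R 1 f * pderiv R 2 g - pderiv R 2 f * pderiv R 1 g)
    + V * (pderiv R 2 f * pderiv R 0 g - pderiv R 0 f * pderiv R 2 g)

lemma seriesBracket_self (f : MvPowerSeries (Fin 3) R) : seriesBracket U V f f = 0 := by
  simp only [seriesBracket]; ring

lemma seriesBracket_add_left (f f' g : MvPowerSeries (Fin 3) R) :
    seriesBracket U V (f + f') g = seriesBracket U V f g + seriesBracket U V f' g := by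
  simp only [seriesBracket, map_add]; ring

lemma seriesBracket_add_right (f g g' : MvPowerSeries (Fin 3) R) :
    seriesBracket U V f (g + g') = seriesBracket U V f g + seriesBracket U V f g' := by
  simp only [seriesBracket, map_add]; ring

lemma seriesBracket_sub_right (f g g' : MvPowerSeries (Fin 3) R) :
    seriesBracket U V f (g - g') = seriesBracket U V f g - seriesBracket U V f g' := by
  simp only [seriesBracket, map_sub]; ring

lemma seriesBracket_X_zero (g : MvPowerSeries (Fin 3) R) :
    seriesBracket U V (X 0) g = X 2 * pderiv R 1 g - V * pderiv R 2 g := by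
  simp [seriesBracket]; ring

lemma seriesBracket_X_one (g : MvPowerSeries (Fin 3) R) :
    seriesBracket U V (X 1) g = U * pderiv R 2 g - X 2 * pderiv R 0 g := by
  simp [seriesBracket]; ring

lemma seriesBracket_X_zero_right (g : MvPowerSeries (Fin 3) R) :
    seriesBracket U V g (X 0) = V * pderiv R 2 g - X 2 * pderiv R 1 g := by
  simp [seriesBracket]; ring

/-- The Jacobi identity for the bracket follows from its instance for `x, y, z`. -/
lemma seriesBracket_jacobi
    (hJ : X 2 * (pderiv R 1 U - pderiv R 0 V) + U * pderiv R 2 V - V * pderiv R 2 U = 0)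
    (f g h : MvPowerSeries (Fin 3) R) :
    seriesBracket U V f (seriesBracket U V g h) + seriesBracket U V g (seriesBracket U V h f)
      + seriesBracket U V h (seriesBracket U V f g) = 0 := by
  simp only [seriesBracket, map_add, map_sub, Derivation.leibniz, smul_eq_mul, pderiv_X_self,
    pderiv_X_of_ne (show (2 : Fin 3) ≠ 0 by decide),
    pderiv_X_of_ne (show (2 : Fin 3) ≠ 1 by decide),
    pderiv_comm 1 0, pderiv_comm 2 0, pderiv_comm 2 1]
  linear_combination
    (pderiv R 0 f * (pderiv R 1 g * pderiv R 2 h - pderiv R 2 g * pderiv R 1 h)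
      + pderiv R 1 f * (pderiv R 2 g * pderiv R 0 h - pderiv R 0 g * pderiv R 2 h)
      + pderiv R 2 f * (pderiv R 0 g * pderiv R 1 h - pderiv R 1 g * pderiv R 0 h)) * hJ

lemma seriesBracket_subst {a : Fin 3 → MvPowerSeries (Fin 3) R}
    (ha : ∀ i, a i ∈ wtIdeal R (varWt i)) (f p : MvPowerSeries (Fin 3) R) :
    seriesBracket U V f (subst a p) =
      ∑ j, subst a (pderiv R j p) * seriesBracket U V f (a j) := by
  simp only [seriesBracket, pderiv_subst ha, Fin.sum_univ_three]
  ring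

lemma seriesBracket_mem_of_left {n : ℕ} {f : MvPowerSeries (Fin 3) R} (hf : f ∈ wtIdeal R (n + 3))
    (g : MvPowerSeries (Fin 3) R) : seriesBracket U V f g ∈ wtIdeal R n := by
  have h : ∀ i, pderiv R i f ∈ wtIdeal R n := fun i =>
    pderiv_mem_wtIdeal_of_le i (by fin_cases i <;> simp [varWt]) hf
  refine add_mem (add_mem ?_ ?_) ?_ <;>
  exact Ideal.mul_mem_left _ _ (sub_mem (Ideal.mul_mem_right _ _ (h _))
    (Ideal.mul_mem_right _ _ (h _)))

lemma seriesBracket_mem {m n k : ℕ} (hk : k + 5 ≤ m + n) {f g : MvPowerSeries (Fin 3) R}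
    (hf : f ∈ wtIdeal R m) (hg : g ∈ wtIdeal R n) : seriesBracket U V f g ∈ wtIdeal R k := by
  have hf' := fun i => pderiv_mem_wtIdeal i hf
  have hg' := fun i => pderiv_mem_wtIdeal i hg
  have hz := X_mem_wtIdeal (R := R) 2
  simp only [varWt] at hf' hg' hz
  refine add_mem (add_mem ?_ ?_) ?_
  · refine mul_mem_wtIdeal_of_le (n := m - 3 + (n - 3)) ?_ hz (sub_mem ?_ ?_)
    · simp; omega
    · exact mul_mem_wtIdeal (hf' 0) (hg' 1)
    · exact mul_mem_wtIdeal (hf' 1) (hg' 0)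
  · refine Ideal.mul_mem_left _ _ (sub_mem ?_ ?_)
    · exact mul_mem_wtIdeal_of_le (by simp; omega) (hf' 1) (hg' 2)
    · exact mul_mem_wtIdeal_of_le (by simp; omega) (hf' 2) (hg' 1)
  · refine Ideal.mul_mem_left _ _ (sub_mem ?_ ?_)
    · exact mul_mem_wtIdeal_of_le (by simp; omega) (hf' 2) (hg' 0)
    · exact mul_mem_wtIdeal_of_le (by simp; omega) (hf' 0) (hg' 2)

/-- The change of coordinates `(x, y, z) ↦ (x, Y, {x, Y})`. Every change that keeps `x` and the
relation `{x, y} = z` is of this form. -/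
noncomputable def coordChange (U V Y : MvPowerSeries (Fin 3) R) : Fin 3 → MvPowerSeries (Fin 3) R :=
  ![X 0, Y, seriesBracket U V (X 0) Y]

lemma coordChange_sub_X_mem {Y : MvPowerSeries (Fin 3) R} (hY : Y - X 1 ∈ wtIdeal R 4) (i : Fin 3) :
    coordChange U V Y i - X i ∈ wtIdeal R (varWt i + 1) := by
  fin_cases i
  · simp [coordChange]
  · simpa [coordChange, varWt] using hY
  · obtain ⟨β, rfl⟩ : ∃ β, Y = X 1 + β := ⟨Y - X 1, by ring⟩
    rw [add_sub_cancel_left] at hY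
    have : seriesBracket U V (X 0) (X 1 + β) - X 2 = X 2 * pderiv R 1 β - V * pderiv R 2 β := by
      simp [seriesBracket_X_zero]; ring
    change seriesBracket U V (X 0) (X 1 + β) - X 2 ∈ wtIdeal R 2
    rw [this]
    exact sub_mem (mul_mem_wtIdeal_of_le (by simp [varWt]) (X_mem_wtIdeal 2)
        (pderiv_mem_wtIdeal 1 hY))
      (Ideal.mul_mem_left _ _ (pderiv_mem_wtIdeal_of_le 2 (by simp [varWt]) hY))

lemma coordChange_mem {Y : MvPowerSeries (Fin 3) R} (hY : Y - X 1 ∈ wtIdeal R 4) (i : Fin 3) :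
    coordChange U V Y i ∈ wtIdeal R (varWt i) := by
  simpa using add_mem (wtIdeal_anti (Nat.le_succ _) (coordChange_sub_X_mem (U := U) (V := V) hY i))
    (X_mem_wtIdeal i)

lemma mem_of_subst_mem {a : Fin 3 → MvPowerSeries (Fin 3) R}
    (ha : ∀ i, a i - X i ∈ wtIdeal R (varWt i + 1)) {n : ℕ} {p : MvPowerSeries (Fin 3) R}
    (hp : subst a p ∈ wtIdeal R n) : p ∈ wtIdeal R n := by
  induction n with
  | zero => exact mem_wtIdeal_zero p
  | succ n ih =>
    have := sub_mem hp (subst_sub_self_mem ha (ih (wtIdeal_anti (Nat.le_succ n) hp)))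
    rwa [sub_sub_cancel] at this

/-- The defect in `{Y, Z} = N_x(x, Y, Z)`, where `Z = {x, Y}`. -/
noncomputable def defectX (U V Y N : MvPowerSeries (Fin 3) R) : MvPowerSeries (Fin 3) R :=
  seriesBracket U V Y (seriesBracket U V (X 0) Y) - subst (coordChange U V Y) (pderiv R 0 N)

/-- The defect in `{Z, x} = N_y(x, Y, Z)`, where `Z = {x, Y}`. -/
noncomputable def defectY (U V Y N : MvPowerSeries (Fin 3) R) : MvPowerSeries (Fin 3) R :=
  seriesBracket U V (seriesBracket U V (X 0) Y) (X 0) - subst (coordChange U V Y) (pderiv R 1 N)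

/-- For `N = f + z g` this is the coefficient of `df ∧ dg`. -/
noncomputable def wedgeCoeff (N : MvPowerSeries (Fin 3) R) : MvPowerSeries (Fin 3) R :=
  pderiv R 0 N * pderiv R 2 (pderiv R 1 N) - pderiv R 1 N * pderiv R 2 (pderiv R 0 N)

lemma pderiv_two_wedgeCoeff {N : MvPowerSeries (Fin 3) R}
    (hN : pderiv R 2 (pderiv R 2 N) = 0) : pderiv R 2 (wedgeCoeff N) = 0 := by
  have h : ∀ i, pderiv R 2 (pderiv R 2 (pderiv R i N)) = 0 := fun i => by
    rw [pderiv_comm 2 i, pderiv_comm 2 i, hN, map_zero]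
  simp only [wedgeCoeff, map_sub, Derivation.leibniz, smul_eq_mul, h]
  ring

/-- The relation between the defects which the Jacobi identity for `x, Y, {x, Y}` imposes. -/
lemma jacobi_defect
    (hJ : X 2 * (pderiv R 1 U - pderiv R 0 V) + U * pderiv R 2 V - V * pderiv R 2 U = 0)
    {Y : MvPowerSeries (Fin 3) R} (hY : Y - X 1 ∈ wtIdeal R 4) (N : MvPowerSeries (Fin 3) R) :
    seriesBracket U V (X 0) (defectX U V Y N) + seriesBracket U V Y (defectY U V Y N)
      + defectX U V Y N * subst (coordChange U V Y) (pderiv R 2 (pderiv R 1 N))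
      - defectY U V Y N * subst (coordChange U V Y) (pderiv R 2 (pderiv R 0 N))
      + subst (coordChange U V Y) (wedgeCoeff N) = 0 := by
  have ha := coordChange_mem (U := U) (V := V) hY
  have hs := hasSubst_of_mem_wtIdeal ha
  have hjac := seriesBracket_jacobi hJ (X 0) Y (seriesBracket U V (X 0) Y)
  have h1 : seriesBracket U V Y (X 0) = - seriesBracket U V (X 0) Y := by
    simp only [seriesBracket]; ring
  have h2 : seriesBracket U V (X 0) (seriesBracket U V (X 0) Y) =
      - seriesBracket U V (seriesBracket U V (X 0) Y) (X 0) := by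
    simp only [seriesBracket]; ring
  have e0 : coordChange U V Y 0 = X 0 := rfl
  have e1 : coordChange U V Y 1 = Y := rfl
  have e2 : coordChange U V Y 2 = seriesBracket U V (X 0) Y := rfl
  simp only [defectX, defectY, wedgeCoeff, seriesBracket_sub_right, seriesBracket_subst ha,
    Fin.sum_univ_three, e0, e1, e2, subst_sub hs, subst_mul hs, seriesBracket_self, h1,
    pderiv_comm 1 0, h2] at hjac ⊢
  linear_combination hjac

/-- The defects form a closed form up to higher weight. In the leading part of the relation between
them, `z (∂_y e₁ - ∂_x e₂)` is divisible by `z`, whereas the contribution of `df ∧ dg` does not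
depend on `z`; so the two vanish separately. -/
lemma pderiv_defectX_sub_pderiv_defectY_mem [Algebra ℝ R]
    (hJ : X 2 * (pderiv R 1 U - pderiv R 0 V) + U * pderiv R 2 V - V * pderiv R 2 U = 0)
    {m : ℕ} {Y N : MvPowerSeries (Fin 3) R} (hY : Y - X 1 ∈ wtIdeal R 4)
    (hN : pderiv R 2 (pderiv R 2 N) = 0) (h1 : defectX U V Y N ∈ wtIdeal R m)
    (h2 : defectY U V Y N ∈ wtIdeal R m) :
    pderiv R 1 (defectX U V Y N) - pderiv R 0 (defectY U V Y N) ∈ wtIdeal R (m - 2) := by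
  rcases lt_or_ge m 2 with hm | hm
  · rw [Nat.sub_eq_zero_of_le hm.le]
    exact mem_wtIdeal_zero _
  obtain ⟨k, rfl⟩ := Nat.exists_eq_add_of_le' hm
  have hjac := jacobi_defect hJ hY N
  set p := defectX U V Y N
  set q := defectY U V Y N
  obtain ⟨β, rfl⟩ : ∃ β, Y = X 1 + β := ⟨Y - X 1, by ring⟩
  have hβ : β ∈ wtIdeal R 4 := by simpa using hY
  have ha := coordChange_sub_X_mem (U := U) (V := V) hY
  set S : MvPowerSeries (Fin 3) R → MvPowerSeries (Fin 3) R := subst (coordChange U V (X 1 + β))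
  -- the terms of weight higher than the leading one in the relation between the defects
  have hr : - V * pderiv R 2 p + U * pderiv R 2 q + seriesBracket U V β q
      + p * S (pderiv R 2 (pderiv R 1 N)) - q * S (pderiv R 2 (pderiv R 0 N))
      ∈ wtIdeal R (k + 1) := by
    refine sub_mem (add_mem (add_mem (add_mem ?_ ?_) ?_) ?_) ?_
    · exact Ideal.mul_mem_left _ _ (pderiv_mem_wtIdeal_of_le 2 (by simp [varWt]) h1)
    · exact Ideal.mul_mem_left _ _ (pderiv_mem_wtIdeal_of_le 2 (by simp [varWt]) h2)
    · exact seriesBracket_mem (by omega) hβ h2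
    · exact Ideal.mul_mem_right _ _ (wtIdeal_anti (by omega) h1)
    · exact Ideal.mul_mem_right _ _ (wtIdeal_anti (by omega) h2)
  have hlead : X 2 * (pderiv R 1 p - pderiv R 0 q) + S (wedgeCoeff N) ∈ wtIdeal R (k + 1) := by
    rw [← neg_mem_iff]
    convert hr using 1
    rw [seriesBracket_X_zero, seriesBracket_add_left, seriesBracket_X_one] at hjac
    linear_combination -hjac
  have hlead' : X 2 * (pderiv R 1 p - pderiv R 0 q) ∈ wtIdeal R k := by
    refine mul_mem_wtIdeal_of_le (m := 1) (n := k + 2 - 3) (by omega) (X_mem_wtIdeal 2)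
      (sub_mem ?_ ?_)
    · exact pderiv_mem_wtIdeal 1 h1
    · exact pderiv_mem_wtIdeal 0 h2
  have hw : wedgeCoeff N ∈ wtIdeal R k := by
    refine mem_of_subst_mem ha ?_
    simpa using sub_mem (wtIdeal_anti (Nat.le_succ k) hlead) hlead'
  rw [Nat.add_sub_cancel]
  refine mem_wtIdeal_of_X_mul_add (pderiv_two_wedgeCoeff hN) ?_
  convert sub_mem hlead (subst_sub_self_mem ha hw) using 1
  simp only [S]
  ring

end Bracket

end Poisson3

namespace Poisson3

open MvPowerSeries

section Approximation

variable {R : Type*} [CommRing R] {U V : MvPowerSeries (Fin 3) R}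

/-- The admissible data `(Y, N)`: `Y` is `y` up to terms of weight at least `4`, and `N` is affine
in `z`, without terms of weight less than `3`. -/
structure IsAdmissible (Y N : MvPowerSeries (Fin 3) R) : Prop where
  sub_mem : Y - X 1 ∈ wtIdeal R 4
  mem : N ∈ wtIdeal R 3
  affine : pderiv R 2 (pderiv R 2 N) = 0

lemma seriesBracket_X_zero_mem {m : ℕ} {B : MvPowerSeries (Fin 3) R} (hB : B ∈ wtIdeal R (m + 4)) :
    seriesBracket U V (X 0) B ∈ wtIdeal R (m + 2) := by
  rw [seriesBracket_X_zero]
  refine sub_mem ?_ (Ideal.mul_mem_left _ _ ?_)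
  · exact mul_mem_wtIdeal_of_le (m := 1) (n := m + 1) (by omega) (X_mem_wtIdeal 2)
      (pderiv_mem_wtIdeal_of_le 1 (by simp [varWt]) hB)
  · exact pderiv_mem_wtIdeal_of_le 2 (by simp [varWt]) hB

lemma subst_coordChange_add_sub_mem {m : ℕ} {Y B : MvPowerSeries (Fin 3) R}
    (hY : Y - X 1 ∈ wtIdeal R 4) (hB : B ∈ wtIdeal R (m + 4)) (p : MvPowerSeries (Fin 3) R) :
    subst (coordChange U V (Y + B)) p - subst (coordChange U V Y) p ∈ wtIdeal R (m + 2) := by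
  have hY' : Y + B - X 1 ∈ wtIdeal R 4 := by
    rw [add_sub_right_comm]
    exact add_mem hY (wtIdeal_anti (by omega) hB)
  refine subst_sub_subst_mem_of_sub_mem (hasSubst_of_mem_wtIdeal (coordChange_mem hY'))
    (hasSubst_of_mem_wtIdeal (coordChange_mem hY)) (fun i => ?_) p
  fin_cases i
  · simp [coordChange]
  · simpa [coordChange] using wtIdeal_anti (by omega) hB
  · simpa [coordChange, seriesBracket_add_right] using seriesBracket_X_zero_mem hB

/-- One step of the approximation: defects of weight at least `m` are corrected to defects of weight
at least `m + 1`. Up to higher weight the defects are the derivatives `H_x, H_y` of a function `H`;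
its part affine in `z` is absorbed by `N`, and the remainder `z² K` by the change
`Y ↦ Y + ∫ K dy`. -/
lemma exists_correction [Algebra ℝ R]
    (hJ : X 2 * (pderiv R 1 U - pderiv R 0 V) + U * pderiv R 2 V - V * pderiv R 2 U = 0)
    {m : ℕ} {Y N : MvPowerSeries (Fin 3) R} (h : IsAdmissible Y N)
    (h1 : defectX U V Y N ∈ wtIdeal R m) (h2 : defectY U V Y N ∈ wtIdeal R m) :
    ∃ Y' N', IsAdmissible Y' N' ∧ defectX U V Y' N' ∈ wtIdeal R (m + 1) ∧
      defectY U V Y' N' ∈ wtIdeal R (m + 1) ∧ Y' - Y ∈ wtIdeal R (m + 4) ∧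
      N' - N ∈ wtIdeal R (m + 3) := by
  have hclosed := pderiv_defectX_sub_pderiv_defectY_mem hJ h.sub_mem h.affine h1 h2
  set p := defectX U V Y N with hp
  set q := defectY U V Y N with hq
  set H := potential p q with hH
  have hHm : H ∈ wtIdeal R (m + 3) := potential_mem_wtIdeal h1 h2
  have hHx : pderiv R 0 H - p ∈ wtIdeal R (m + 1) :=
    wtIdeal_anti (by omega) (pderiv_zero_potential_sub_mem hclosed)
  have hHy : pderiv R 1 H = q := pderiv_one_potential p q
  set L := affinePart H
  set K := quadraticPart H
  have hHLK : L + X 2 ^ 2 * K = H := affinePart_add_quadraticPart H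
  have hL : L ∈ wtIdeal R (m + 3) := affinePart_mem_wtIdeal hHm
  have hK : K ∈ wtIdeal R (m + 1) := quadraticPart_mem_wtIdeal hHm
  set B := potential 0 K
  have hB : B ∈ wtIdeal R (m + 4) := potential_mem_wtIdeal (zero_mem _) hK
  have hBy : pderiv R 1 B = K := pderiv_one_potential 0 K
  have hY' : Y + B - X 1 ∈ wtIdeal R 4 := by
    rw [add_sub_right_comm]
    exact add_mem h.sub_mem (wtIdeal_anti (by omega) hB)
  have hS := subst_coordChange_add_sub_mem (U := U) (V := V) h.sub_mem hB
  have hSL := fun i (hi : varWt i ≤ 3) => subst_sub_self_mem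
    (coordChange_sub_X_mem (U := U) (V := V) hY')
    (pderiv_mem_wtIdeal_of_le (k := m) i (by omega) hL)
  have hsubst := hasSubst_of_mem_wtIdeal (coordChange_mem (U := U) (V := V) hY')
  set C := seriesBracket U V (X 0) B with hC
  have hCm : C ∈ wtIdeal R (m + 2) := seriesBracket_X_zero_mem hB
  have hCe : C = X 2 * K - V * pderiv R 2 B := by rw [hC, seriesBracket_X_zero, hBy]
  -- the terms of weight at least `m + 1` which the derivatives of `C` contribute
  have hVB : ∀ i, varWt i ≤ 3 → X 2 * pderiv R i (V * pderiv R 2 B) ∈ wtIdeal R (m + 1) :=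
    fun i hi => mul_mem_wtIdeal_of_le (m := 1) (n := m) (by omega) (X_mem_wtIdeal 2)
      (pderiv_mem_wtIdeal_of_le (n := m + 3) i (by omega)
        (Ideal.mul_mem_left _ _ (pderiv_mem_wtIdeal_of_le 2 (by simp [varWt]) hB)))
  have hCz : pderiv R 2 C ∈ wtIdeal R (m + 1) := pderiv_mem_wtIdeal_of_le 2 (by simp [varWt]) hCm
  have hCd : ∀ i, i ≠ 2 → pderiv R i C = X 2 * pderiv R i K - pderiv R i (V * pderiv R 2 B) := by
    intro i hi
    rw [hCe, map_sub, Derivation.leibniz, pderiv_X_of_ne hi.symm, smul_zero, add_zero, smul_eq_mul]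
  have hHd : ∀ i, i ≠ 2 → pderiv R i H = pderiv R i L + X 2 ^ 2 * pderiv R i K := by
    intro i hi
    rw [← hHLK, map_add, Derivation.leibniz, pderiv_pow, pderiv_X_of_ne hi.symm]
    simp
  refine ⟨Y + B, N + L, ⟨hY', add_mem h.mem (wtIdeal_anti (by omega) hL), ?_⟩, ?_, ?_, ?_, ?_⟩
  · rw [map_add, map_add, h.affine, pderiv_two_pderiv_two_affinePart, add_zero]
  · obtain ⟨β, rfl⟩ : ∃ β, Y = X 1 + β := ⟨Y - X 1, by ring⟩
    have hβ : β ∈ wtIdeal R 4 := by simpa using h.sub_mem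
    have hβC : seriesBracket U V β C ∈ wtIdeal R (m + 1) := seriesBracket_mem (by omega) hβ hCm
    have hBZ : seriesBracket U V B (seriesBracket U V (X 0) (X 1 + β) + C) ∈ wtIdeal R (m + 1) :=
      seriesBracket_mem_of_left hB _
    have hUC : U * pderiv R 2 C ∈ wtIdeal R (m + 1) := Ideal.mul_mem_left _ _ hCz
    have key : defectX U V (X 1 + β + B) (N + L) =
        -(subst (coordChange U V (X 1 + β + B)) (pderiv R 0 N)
            - subst (coordChange U V (X 1 + β)) (pderiv R 0 N))
        - (subst (coordChange U V (X 1 + β + B)) (pderiv R 0 L) - pderiv R 0 L)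
        - (pderiv R 0 H - p) + X 2 * pderiv R 0 (V * pderiv R 2 B) + U * pderiv R 2 C
        + seriesBracket U V β C
        + seriesBracket U V B (seriesBracket U V (X 0) (X 1 + β) + C) := by
      rw [hHd 0 (by decide), hp, defectX, defectX, map_add, subst_add hsubst,
        seriesBracket_add_right (X 0) (X 1 + β) B, ← hC, seriesBracket_add_left _ B,
        seriesBracket_add_right _ _ C, seriesBracket_add_left (X 1) β C, seriesBracket_X_one C,
        hCd 0 (by decide)]
      ring
    rw [key]
    exact add_mem (add_mem (add_mem (add_mem (sub_mem (sub_mem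
      (neg_mem (wtIdeal_anti (by omega) (hS _))) (hSL 0 (by simp [varWt]))) hHx)
      (hVB 0 (by simp [varWt]))) hUC) hβC) hBZ
  · have key : defectY U V (Y + B) (N + L) =
        -(subst (coordChange U V (Y + B)) (pderiv R 1 N)
            - subst (coordChange U V Y) (pderiv R 1 N))
        - (subst (coordChange U V (Y + B)) (pderiv R 1 L) - pderiv R 1 L)
        + X 2 * pderiv R 1 (V * pderiv R 2 B) + V * pderiv R 2 C := by
      have hq' : pderiv R 1 L + X 2 ^ 2 * pderiv R 1 K = q := by rw [← hHd 1 (by decide), hHy]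
      rw [hq, defectY] at hq'
      rw [defectY, map_add, subst_add hsubst, seriesBracket_add_right (X 0) Y B, ← hC,
        seriesBracket_add_left, seriesBracket_X_zero_right C, hCd 1 (by decide)]
      linear_combination -hq'
    rw [key]
    exact add_mem (add_mem (sub_mem (neg_mem (wtIdeal_anti (by omega) (hS _)))
      (hSL 1 (by simp [varWt]))) (hVB 1 (by simp [varWt]))) (Ideal.mul_mem_left _ _ hCz)
  · simpa using hB
  · simpa using hL

/-- Completeness of the weight filtration. -/
lemma exists_limit (c : ℕ) (y : ℕ → MvPowerSeries (Fin 3) R)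
    (hy : ∀ m, y (m + 1) - y m ∈ wtIdeal R (m + c)) :
    ∃ Y, ∀ m, Y - y m ∈ wtIdeal R (m + c) := by
  have hcauchy : ∀ m k, y (m + k) - y m ∈ wtIdeal R (m + c) := by
    intro m k
    induction k with
    | zero => simp
    | succ k ih =>
      have := add_mem (wtIdeal_anti (by omega) (hy (m + k))) ih
      rwa [sub_add_sub_cancel] at this
  let Y : MvPowerSeries (Fin 3) R := fun d => coeff d (y (wt d + 1))
  have hY : ∀ d, coeff d Y = coeff d (y (wt d + 1)) := fun _ => rfl
  refine ⟨Y, fun m d hd => ?_⟩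
  rw [map_sub, sub_eq_zero, hY]
  rcases le_total m (wt d + 1) with h | h
  · obtain ⟨k, hk⟩ := Nat.exists_eq_add_of_le h
    rw [hk, ← sub_eq_zero, ← map_sub]
    exact hcauchy m k d hd
  · obtain ⟨k, hk⟩ := Nat.exists_eq_add_of_le h
    rw [hk, eq_comm, ← sub_eq_zero, ← map_sub]
    exact hcauchy (wt d + 1) k d (by omega)

/-- The formal normal form over an arbitrary coefficient algebra. -/
theorem exists_normalisation [Algebra ℝ R]
    (hJ : X 2 * (pderiv R 1 U - pderiv R 0 V) + U * pderiv R 2 V - V * pderiv R 2 U = 0) :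
    ∃ Y N, IsAdmissible Y N ∧ defectX U V Y N = 0 ∧ defectY U V Y N = 0 ∧ wedgeCoeff N = 0 := by
  let Good (m : ℕ) (s : MvPowerSeries (Fin 3) R × MvPowerSeries (Fin 3) R) : Prop :=
    IsAdmissible s.1 s.2 ∧ defectX U V s.1 s.2 ∈ wtIdeal R m ∧ defectY U V s.1 s.2 ∈ wtIdeal R m
  have step : ∀ m (s : {s // Good m s}), ∃ t : {t // Good (m + 1) t},
      t.1.1 - s.1.1 ∈ wtIdeal R (m + 4) ∧ t.1.2 - s.1.2 ∈ wtIdeal R (m + 3) := by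
    rintro m ⟨s, hs, h1, h2⟩
    obtain ⟨Y', N', h, h1', h2', hY, hN⟩ := exists_correction hJ hs h1 h2
    exact ⟨⟨(Y', N'), h, h1', h2'⟩, hY, hN⟩
  choose F hFY hFN using step
  have h0 : Good 0 (X 1, 0) :=
    ⟨⟨by simp, zero_mem _, by simp⟩, mem_wtIdeal_zero _, mem_wtIdeal_zero _⟩
  let s : ∀ m, {s // Good m s} := fun m =>
    Nat.rec (motive := fun m => {s // Good m s}) ⟨(X 1, 0), h0⟩ F m
  obtain ⟨Y, hY⟩ := exists_limit 4 (fun m => (s m).1.1) fun m => hFY m (s m)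
  obtain ⟨N, hN⟩ := exists_limit 3 (fun m => (s m).1.2) fun m => hFN m (s m)
  have hY1 : Y - X 1 ∈ wtIdeal R 4 := hY 0
  have hadm : IsAdmissible Y N := by
    refine ⟨hY1, by simpa [s] using hN 0, eq_zero_of_forall_mem_wtIdeal fun m => ?_⟩
    have := pderiv_mem_wtIdeal_of_le (k := m) 2 (by simp [varWt])
      (pderiv_mem_wtIdeal_of_le (k := m + 1) 2 (by simp [varWt]) (hN m))
    simpa only [map_sub, (s m).2.1.affine, sub_zero] using this
  -- the defects of the limit are those of the approximations up to high weight
  have hlim : ∀ m, defectX U V Y N ∈ wtIdeal R m ∧ defectY U V Y N ∈ wtIdeal R m := by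
    intro m
    obtain ⟨hs, h1, h2⟩ := (s (m + 1)).2
    have hYm := hY (m + 1)
    have hNm := hN (m + 1)
    set Y' := (s (m + 1)).1.1
    set N' := (s (m + 1)).1.2
    obtain ⟨B, rfl⟩ : ∃ B, Y = Y' + B := ⟨Y - Y', by ring⟩
    obtain ⟨L, rfl⟩ : ∃ L, N = N' + L := ⟨N - N', by ring⟩
    simp only [add_sub_cancel_left] at hYm hNm
    have hC := seriesBracket_X_zero_mem (U := U) (V := V) hYm
    have hS := subst_coordChange_add_sub_mem (U := U) (V := V) hs.sub_mem hYm
    have hsubst := hasSubst_of_mem_wtIdeal (coordChange_mem (U := U) (V := V) hY1)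
    have hSL := fun i (hi : varWt i ≤ 3) => subst_mem_wtIdeal
      (coordChange_mem (U := U) (V := V) hY1)
      (pderiv_mem_wtIdeal_of_le (k := m) i (by omega) hNm)
    set C := seriesBracket U V (X 0) B
    have hanti : ∀ f g : MvPowerSeries (Fin 3) R, seriesBracket U V f g = -seriesBracket U V g f :=
      fun f g => by simp only [seriesBracket]; ring
    constructor
    · have key : defectX U V (Y' + B) (N' + L) = defectX U V Y' N'
          + seriesBracket U V B (seriesBracket U V (X 0) (Y' + B))
          - seriesBracket U V C Y'
          - (subst (coordChange U V (Y' + B)) (pderiv R 0 N')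
            - subst (coordChange U V Y') (pderiv R 0 N'))
          - subst (coordChange U V (Y' + B)) (pderiv R 0 L) := by
        rw [defectX, defectX, map_add, subst_add hsubst, seriesBracket_add_left Y' B,
          seriesBracket_add_right (X 0) Y' B, seriesBracket_add_right Y', hanti C Y']
        ring
      rw [key]
      exact sub_mem (sub_mem (sub_mem (add_mem (wtIdeal_anti (by omega) h1)
        (seriesBracket_mem_of_left (wtIdeal_anti (by omega) hYm) _))
        (seriesBracket_mem_of_left (wtIdeal_anti (by omega) hC) _))
        (wtIdeal_anti (by omega) (hS _))) (hSL 0 (by simp [varWt]))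
    · have key : defectY U V (Y' + B) (N' + L) = defectY U V Y' N'
          + seriesBracket U V C (X 0)
          - (subst (coordChange U V (Y' + B)) (pderiv R 1 N')
            - subst (coordChange U V Y') (pderiv R 1 N'))
          - subst (coordChange U V (Y' + B)) (pderiv R 1 L) := by
        rw [defectY, defectY, map_add, subst_add hsubst, seriesBracket_add_right (X 0) Y' B,
          seriesBracket_add_left _ C]
        ring
      rw [key]
      exact sub_mem (sub_mem (add_mem (wtIdeal_anti (by omega) h2)
        (seriesBracket_mem_of_left (wtIdeal_anti (by omega) hC) _))
        (wtIdeal_anti (by omega) (hS _))) (hSL 1 (by simp [varWt]))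
  have hX0 := eq_zero_of_forall_mem_wtIdeal fun m => (hlim m).1
  have hY0 := eq_zero_of_forall_mem_wtIdeal fun m => (hlim m).2
  refine ⟨Y, N, hadm, hX0, hY0, eq_zero_of_subst_eq_zero
    (coordChange_sub_X_mem (U := U) (V := V) hY1) ?_⟩
  have h00 : ∀ f : MvPowerSeries (Fin 3) R, seriesBracket U V f 0 = 0 := fun f => by
    simp [seriesBracket]
  simpa [hX0, hY0, h00] using jacobi_defect hJ hY1 N

end Approximation

end Poisson3

/-! ### From series over a ring of functions to families of formal changes -/

namespace Poisson3

open MvPowerSeries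

section Affine

/-- The monomial `x^a y^b z^k`, for `x^a y^b` given by `e`. -/
noncomputable def extend (e : Fin 2 →₀ ℕ) (k : ℕ) : Fin 3 →₀ ℕ :=
  e.embDomain Fin.castSuccEmb + Finsupp.single 2 k

lemma extend_two (e : Fin 2 →₀ ℕ) (k : ℕ) : extend e k 2 = k := by
  have : e.embDomain Fin.castSuccEmb 2 = 0 :=
    Finsupp.embDomain_of_notMem_range _ _ _ (by simp)
  simp [extend, this]

lemma extend_castSucc (e : Fin 2 →₀ ℕ) (k : ℕ) (i : Fin 2) : extend e k i.castSucc = e i := by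
  have h : e.embDomain Fin.castSuccEmb (Fin.castSuccEmb i) = e i := Finsupp.embDomain_apply_self ..
  have h2 : (2 : Fin 3) ≠ i.castSucc := by fin_cases i <;> decide
  simp only [Fin.coe_castSuccEmb] at h
  simp [extend, h, h2]

lemma exists_eq_extend (d : Fin 3 →₀ ℕ) : ∃ e, d = extend e (d 2) := by
  refine ⟨Finsupp.equivFunOnFinite.symm fun i => d i.castSucc, ?_⟩
  ext i
  refine Fin.lastCases ?_ (fun i => ?_) i
  · exact (extend_two _ _).symm
  · rw [extend_castSucc]; rfl

lemma extend_add_single (e : Fin 2 →₀ ℕ) (k : ℕ) (i : Fin 2) :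
    extend e k + Finsupp.single i.castSucc 1 = extend (e + Finsupp.single i 1) k := by
  rw [extend, extend, Finsupp.embDomain_add, Finsupp.embDomain_single, add_right_comm]
  rfl

lemma coeff_incl (f : Series2) (e : Fin 2 →₀ ℕ) (k : ℕ) :
    coeff (extend e k) (incl f) = if k = 0 then coeff e f else 0 := by
  split_ifs with hk
  · subst hk
    rw [extend, Finsupp.single_zero, add_zero]
    exact coeff_embDomain_rename Fin.castSuccEmb f e
  · refine coeff_rename_eq_zero _ _ ?_
    rintro ⟨e', he'⟩
    have h2 := extend_two e k
    rw [← he', Finsupp.mapDomain_of_notMem_range _ _ (by simp)] at h2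
    exact hk h2.symm

lemma pderiv_incl (i : Fin 2) (f : Series2) :
    pderiv ℝ i.castSucc (incl f) = incl (pderiv ℝ i f) := by
  ext d
  obtain ⟨e, he⟩ := exists_eq_extend d
  rw [he, coeff_pderiv, extend_add_single, coeff_incl, coeff_incl, coeff_pderiv, extend_castSucc]
  split_ifs <;> simp

lemma pderiv_two_incl (f : Series2) : pderiv ℝ 2 (incl f) = 0 := by
  ext d
  obtain ⟨e, he⟩ := exists_eq_extend (d + Finsupp.single 2 1)
  rw [coeff_pderiv, he, coeff_incl, if_neg (by simp), zero_mul, map_zero]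

lemma coeff_X_two_mul_incl (g : Series2) (e : Fin 2 →₀ ℕ) (k : ℕ) :
    coeff (extend e k) (X 2 * incl g) = if k = 1 then coeff e g else 0 := by
  rcases k with _ | k
  · simpa using coeff_X_pow_mul_of_lt (incl g) (k := 1) (d := extend e 0) (by simp [extend_two])
  · have : extend e (k + 1) = extend e k + Finsupp.single 2 1 := by
      simp [extend, add_assoc, ← Finsupp.single_add]
    have h := coeff_add_X_pow_mul (incl g) 1 (extend e k)
    rw [pow_one] at h
    rw [this, h, coeff_incl]
    simp

/-- The coefficient of `z^k`, as a series in `x, y`. -/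
noncomputable def zCoeff (k : ℕ) (N : Series3) : Series2 := fun e => coeff (extend e k) N

lemma coeff_zCoeff (k : ℕ) (N : Series3) (e : Fin 2 →₀ ℕ) :
    coeff e (zCoeff k N) = coeff (extend e k) N := rfl

lemma eq_incl_add_X_mul_incl {N : Series3} (hN : pderiv ℝ 2 (pderiv ℝ 2 N) = 0) :
    N = incl (zCoeff 0 N) + X 2 * incl (zCoeff 1 N) := by
  ext d
  obtain ⟨e, he⟩ := exists_eq_extend d
  rw [he, map_add, coeff_incl, coeff_X_two_mul_incl]
  rcases h : d 2 with _ | _ | k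
  · simp [coeff_zCoeff]
  · simp [coeff_zCoeff]
  · have h1 := congrArg (coeff (extend e k)) hN
    have h2 : extend e k + Finsupp.single 2 1 + Finsupp.single 2 1 = extend e (k + 1 + 1) := by
      simp [extend, add_assoc, ← Finsupp.single_add]
    rw [coeff_pderiv, coeff_pderiv, h2, map_zero] at h1
    have h3 : ∀ n : ℕ, (n : ℝ) + 1 ≠ 0 := fun n => by positivity
    simpa only [mul_eq_zero, h3, or_false, Nat.add_eq_zero_iff, one_ne_zero, and_false, if_false,
      Nat.add_eq_right, add_zero] using h1

end Affine

section Families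

variable {l : ℕ}

lemma formalBracket_skew (U V f g : Series3) :
    formalBracket (skew (X 2) U V) f g = seriesBracket U V f g := by
  simp only [formalBracket, seriesBracket, skew, Fin.sum_univ_three]
  simp
  ring

lemma map_pderiv {R S : Type*} [CommRing R] [CommRing S] (h : R →+* S) (i : Fin 3)
    (f : MvPowerSeries (Fin 3) R) : map h (pderiv R i f) = pderiv S i (map h f) := by
  ext d
  simp [coeff_pderiv]

lemma map_seriesBracket {R S : Type*} [CommRing R] [CommRing S] (h : R →+* S)
    (U V f g : MvPowerSeries (Fin 3) R) :
    map h (seriesBracket U V f g) = seriesBracket (map h U) (map h V) (map h f) (map h g) := by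
  simp [seriesBracket, map_pderiv]

lemma map_mem_wtIdeal {R S : Type*} [CommRing R] [CommRing S] (h : R →+* S) {n : ℕ}
    {f : MvPowerSeries (Fin 3) R} (hf : f ∈ wtIdeal R n) : map h f ∈ wtIdeal S n := by
  intro d hd
  rw [coeff_map, hf d hd, map_zero]

/-- The algebra of the functions of the parameter that are smooth on `W`. -/
def smoothOn (W : Set (Param l)) : Subalgebra ℝ (Param l → ℝ) where
  carrier := {f | ContDiffOn ℝ ∞ f W}
  mul_mem' hf hg := ContDiffOn.mul hf hg
  add_mem' hf hg := ContDiffOn.add hf hg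
  algebraMap_mem' _ := contDiffOn_const

/-- Evaluation at a value of the parameter. -/
def evalAt (W : Set (Param l)) (ε : Param l) : smoothOn W →+* ℝ :=
  (Pi.evalRingHom (fun _ => ℝ) ε).comp (smoothOn W).val.toRingHom

lemma evalAt_apply (W : Set (Param l)) (ε : Param l) (f : smoothOn W) :
    evalAt W ε f = (f : Param l → ℝ) ε := rfl

lemma smoothSeriesOn_map {W : Set (Param l)} (f : MvPowerSeries (Fin 3) (smoothOn W)) :
    SmoothSeriesOn W fun ε => map (evalAt W ε) f := fun n => by
  simp only [coeff_map, evalAt_apply]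
  exact (coeff n f).2

lemma eq_zero_of_forall_map {W : Set (Param l)} {f : MvPowerSeries (Fin 3) (smoothOn W)}
    (hf : ∀ ε, map (evalAt W ε) f = 0) : f = 0 := by
  ext n ε
  have := congrArg (coeff n) (hf ε)
  rwa [coeff_map, evalAt_apply, map_zero] at this

open Classical in
/-- A family of series that is smooth on `W` comes from a series over `smoothOn W`; it is extended
by zero outside of `W`, so that identities valid on `W` lift. -/
lemma exists_lift {W : Set (Param l)} {f : Param l → Series3} (hf : SmoothSeriesOn W f) :
    ∃ F : MvPowerSeries (Fin 3) (smoothOn W),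
      ∀ ε, map (evalAt W ε) F = if ε ∈ W then f ε else 0 := by
  let F : MvPowerSeries (Fin 3) (smoothOn W) := fun n =>
    ⟨fun ε => if ε ∈ W then coeff n (f ε) else 0, (hf n).congr fun ε hε => if_pos hε⟩
  have hF : ∀ n ε, ((coeff n F : smoothOn W) : Param l → ℝ) ε =
      if ε ∈ W then coeff n (f ε) else 0 :=
    fun _ _ => rfl
  refine ⟨F, fun ε => ?_⟩
  ext n
  rw [coeff_map, evalAt_apply, hF]
  split_ifs <;> simp

lemma isFormalChange_of_sub_X_mem {φ : Fin 3 → Series3}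
    (h : ∀ i, φ i - X i ∈ wtIdeal ℝ (varWt i + 1)) : IsFormalChange φ := by
  have h' : ∀ i, φ i ∈ wtIdeal ℝ (varWt i) := fun i => by
    simpa using add_mem (wtIdeal_anti (Nat.le_succ _) (h i)) (X_mem_wtIdeal i)
  refine ⟨fun i => constantCoeff_eq_zero_of_mem_wtIdeal (by fin_cases i <;> simp [varWt]) (h' i),
    ?_⟩
  have hc : ∀ i j, varWt j ≤ varWt i →
      coeff (Finsupp.single j 1) (φ i) = if i = j then 1 else 0 := by
    intro i j hij
    have := h i (Finsupp.single j 1) (by rw [wt_single]; omega)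
    rw [map_sub, sub_eq_zero] at this
    rw [this, coeff_X]
    simp [Finsupp.single_left_inj, eq_comm]
  rw [Matrix.det_fin_three]
  simp [hc 0 0 le_rfl, hc 0 1 le_rfl, hc 0 2 (by simp [varWt]), hc 1 0 le_rfl, hc 1 1 le_rfl,
    hc 1 2 (by simp [varWt]), hc 2 2 le_rfl]

lemma formallySends_skew {φ : Fin 3 → Series3} (hs : HasSubst φ) {U V p q : Series3}
    (h01 : seriesBracket U V (φ 0) (φ 1) = φ 2)
    (h12 : seriesBracket U V (φ 1) (φ 2) = subst φ p)
    (h20 : seriesBracket U V (φ 2) (φ 0) = subst φ q) :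
    FormallySends φ (skew (X 2) U V) (skew (X 2) p q) := by
  have hanti : ∀ f g, seriesBracket U V f g = -seriesBracket U V g f :=
    fun f g => by simp only [seriesBracket]; ring
  have hneg : ∀ p : Series3, subst φ (-p) = -subst φ p := fun p => by
    rw [← coe_substAlgHom hs, map_neg]
  have hzero : subst φ (0 : Series3) = 0 := by rw [← coe_substAlgHom hs, map_zero]
  intro i j
  rw [formalBracket_skew]
  fin_cases i <;> fin_cases j <;> simp [skew, hneg, hzero, seriesBracket_self, subst_X hs]
  · exact h01
  · rw [hanti, h20]
  · rw [hanti, h01]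
  · exact h12
  · exact h20
  · rw [hanti, h12]

/-- The normal form, for families of formal 2-vectors `{x,y} = z`, `{y,z} = U`, `{z,x} = V`
satisfying the Jacobi identity. -/
theorem exists_formal_reduction {W : Set (Param l)} {U V : Param l → Series3}
    (hU : SmoothSeriesOn W U) (hV : SmoothSeriesOn W V)
    (hJ : ∀ ε ∈ W, X 2 * (pderiv ℝ 1 (U ε) - pderiv ℝ 0 (V ε)) + U ε * pderiv ℝ 2 (V ε)
      - V ε * pderiv ℝ 2 (U ε) = 0) :
    ∃ (φ : Param l → Fin 3 → Series3) (f g : Param l → Series2),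
      (∀ i, SmoothSeriesOn W fun ε => φ ε i) ∧ SmoothSeriesOn W f ∧ SmoothSeriesOn W g ∧
      ∀ ε ∈ W,
        IsFormalChange (φ ε) ∧
        FormallySends (φ ε) (skew (X 2) (U ε) (V ε)) (normalForm (f ε) (g ε)) ∧
        constantCoeff (f ε) = 0 ∧ constantCoeff (g ε) = 0 ∧
        pderiv ℝ 0 (f ε) * pderiv ℝ 1 (g ε) - pderiv ℝ 1 (f ε) * pderiv ℝ 0 (g ε) = 0 := by
  obtain ⟨U', hU'⟩ := exists_lift hU
  obtain ⟨V', hV'⟩ := exists_lift hV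
  have hJ' : X 2 * (pderiv _ 1 U' - pderiv _ 0 V') + U' * pderiv _ 2 V' - V' * pderiv _ 2 U'
      = 0 := by
    refine eq_zero_of_forall_map fun ε => ?_
    simp only [map_add, map_sub, map_mul, map_pderiv, hU', hV', map_X]
    split_ifs with hε
    · exact hJ ε hε
    · simp
  obtain ⟨Y, N, hYN, hX, hY, hw⟩ := exists_normalisation hJ'
  refine ⟨fun ε i => map (evalAt W ε) (coordChange U' V' Y i),
    fun ε => zCoeff 0 (map (evalAt W ε) N), fun ε => zCoeff 1 (map (evalAt W ε) N),
    fun i => smoothSeriesOn_map _, fun e => smoothSeriesOn_map N (extend e 0),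
    fun e => smoothSeriesOn_map N (extend e 1), fun ε hε => ?_⟩
  have hUε : map (evalAt W ε) U' = U ε := by rw [hU', if_pos hε]
  have hVε : map (evalAt W ε) V' = V ε := by rw [hV', if_pos hε]
  set φ : Fin 3 → Series3 := fun i => map (evalAt W ε) (coordChange U' V' Y i) with hφ
  have hφX : ∀ i, φ i - X i ∈ wtIdeal ℝ (varWt i + 1) := fun i => by
    have := map_mem_wtIdeal (evalAt W ε)
      (coordChange_sub_X_mem (U := U') (V := V') hYN.sub_mem i)
    rwa [map_sub, map_X] at this
  have hφ' : IsFormalChange φ := isFormalChange_of_sub_X_mem hφX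
  have hs : HasSubst φ := hasSubst_of_constantCoeff_zero hφ'.1
  have hsR := hasSubst_of_mem_wtIdeal (coordChange_mem (U := U') (V := V') hYN.sub_mem)
  have h01 : seriesBracket (U ε) (V ε) (φ 0) (φ 1) = φ 2 := by
    rw [← hUε, ← hVε, hφ, ← map_seriesBracket]
    rfl
  have h12 : seriesBracket (U ε) (V ε) (φ 1) (φ 2) =
      subst φ (pderiv ℝ 0 (map (evalAt W ε) N)) := by
    rw [← hUε, ← hVε, hφ, ← map_seriesBracket, ← map_pderiv, ← map_subst hsR]
    exact congrArg _ (sub_eq_zero.1 hX)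
  have h20 : seriesBracket (U ε) (V ε) (φ 2) (φ 0) =
      subst φ (pderiv ℝ 1 (map (evalAt W ε) N)) := by
    rw [← hUε, ← hVε, hφ, ← map_seriesBracket, ← map_pderiv, ← map_subst hsR]
    exact congrArg _ (sub_eq_zero.1 hY)
  have hwε : wedgeCoeff (map (evalAt W ε) N) = 0 := by
    simpa [wedgeCoeff, map_pderiv] using congrArg (MvPowerSeries.map (evalAt W ε)) hw
  have hN3 := map_mem_wtIdeal (evalAt W ε) hYN.mem
  have hNz : pderiv ℝ 2 (pderiv ℝ 2 (map (evalAt W ε) N)) = 0 := by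
    simpa [map_pderiv] using congrArg (MvPowerSeries.map (evalAt W ε)) hYN.affine
  set M := map (evalAt W ε) N
  have hM := eq_incl_add_X_mul_incl hNz
  have hMd : ∀ i : Fin 2, pderiv ℝ i.castSucc M =
      incl (pderiv ℝ i (zCoeff 0 M)) + X 2 * incl (pderiv ℝ i (zCoeff 1 M)) := by
    intro i
    conv_lhs => rw [hM]
    rw [map_add, Derivation.leibniz, pderiv_incl, pderiv_incl,
      pderiv_X_of_ne (by fin_cases i <;> decide)]
    simp
  have hM0 := hMd 0
  have hM1 := hMd 1
  simp only [Fin.castSucc_zero, Fin.castSucc_one] at hM0 hM1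
  refine ⟨hφ', ?_, ?_, ?_, ?_⟩
  · rw [normalForm, ← hM0, ← hM1]
    exact formallySends_skew hs h01 h12 h20
  · rw [← coeff_zero_eq_constantCoeff_apply, coeff_zCoeff]
    exact hN3 _ (by simp [wt, extend])
  · rw [← coeff_zero_eq_constantCoeff_apply, coeff_zCoeff]
    exact hN3 _ (by simp [wt, extend])
  · refine rename_injective (R := ℝ) Fin.castSuccEmb ?_
    change incl _ = rename (R := ℝ) Fin.castSuccEmb 0
    rw [map_zero]
    have hsub : ∀ p q : Series2, incl (p - q) = incl p - incl q := fun p q => map_sub _ _ _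
    have hmul : ∀ p q : Series2, incl (p * q) = incl p * incl q := fun p q => map_mul _ _ _
    have hz : ∀ p q : Series2, pderiv ℝ 2 (incl p + X 2 * incl q) = incl q := fun p q => by
      rw [map_add, Derivation.leibniz, pderiv_two_incl, pderiv_two_incl]
      simp
    rw [wedgeCoeff, hM0, hM1, hz, hz] at hwε
    rw [hsub, hmul, hmul]
    linear_combination hwε

end Families

end Poisson3

/-! ### Taylor series -/

namespace Poisson3

section Derivatives

lemma contDiffAt_partialD {f : R3 → ℝ} {x : R3} (hf : ContDiffAt ℝ ∞ f x) (i : Fin 3) :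
    ContDiffAt ℝ ∞ (partialD i f) x :=
  (hf.fderiv_right (m := ∞) (by simp)).clm_apply contDiffAt_const

lemma partialD_congr {f g : R3 → ℝ} {x : R3} (h : f =ᶠ[𝓝 x] g) (i : Fin 3) :
    partialD i f =ᶠ[𝓝 x] partialD i g :=
  (h.fderiv (𝕜 := ℝ)).mono fun y hy => by simp only [partialD, hy]

lemma partialD_congr_self {f g : R3 → ℝ} {x : R3} (h : f =ᶠ[𝓝 x] g) (i : Fin 3) :
    partialD i f x = partialD i g x :=
  (partialD_congr h i).self_of_nhds

lemma partialD_add {f g : R3 → ℝ} {x : R3} (hf : DifferentiableAt ℝ f x)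
    (hg : DifferentiableAt ℝ g x) (i : Fin 3) :
    partialD i (fun y => f y + g y) x = partialD i f x + partialD i g x := by
  simp [partialD, fderiv_fun_add hf hg]

lemma partialD_mul {f g : R3 → ℝ} {x : R3} (hf : DifferentiableAt ℝ f x)
    (hg : DifferentiableAt ℝ g x) (i : Fin 3) :
    partialD i (fun y => f y * g y) x = f x * partialD i g x + g x * partialD i f x := by
  simp [partialD, fderiv_fun_mul hf hg]

lemma partialD_const (i : Fin 3) (c : ℝ) : partialD i (fun _ => c) = fun _ => 0 := by
  ext x
  simp [partialD]

lemma partialD_coord (i j : Fin 3) :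
    partialD i (fun x => x j) = fun _ => if j = i then 1 else 0 := by
  ext x
  have : (fun x : R3 => x j) = ContinuousLinearMap.proj (R := ℝ) (φ := fun _ : Fin 3 => ℝ) j := rfl
  rw [partialD, this, ContinuousLinearMap.fderiv]
  simp [Pi.single_apply]

lemma partialD_comm {f : R3 → ℝ} {x : R3} (hf : ContDiffAt ℝ ∞ f x) (i j : Fin 3) :
    partialD i (partialD j f) x = partialD j (partialD i f) x := by
  have hd : DifferentiableAt ℝ (fderiv ℝ f) x :=
    (hf.fderiv_right (m := 1) (by norm_cast)).differentiableAt (by simp)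
  have h2 : ∀ a b : Fin 3, partialD a (partialD b f) x =
      fderiv ℝ (fderiv ℝ f) x (Pi.single a 1) (Pi.single b 1) := by
    intro a b
    have : partialD b f = fun y => fderiv ℝ f y (Pi.single b 1) := rfl
    rw [this, partialD, fderiv_clm_apply hd (by fun_prop)]
    simp
  rw [h2, h2]
  exact hf.isSymmSndFDerivAt (by simpa using ENat.LEInfty.out) _ _

end Derivatives

section Taylor

/-- Smoothness in a neighbourhood of the origin. (For `∞`, this is stronger than `ContDiffAt` at
the origin, which only bounds the neighbourhood for each finite order separately.) -/
def SmoothNear (f : R3 → ℝ) : Prop := ∀ᶠ x in 𝓝 (0 : R3), ContDiffAt ℝ ∞ f x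

lemma SmoothNear.partialD {f : R3 → ℝ} (hf : SmoothNear f) (i : Fin 3) :
    SmoothNear (partialD i f) :=
  Filter.Eventually.mono hf fun _ hx => contDiffAt_partialD hx i

lemma SmoothNear.add {f g : R3 → ℝ} (hf : SmoothNear f) (hg : SmoothNear g) :
    SmoothNear fun x => f x + g x := by
  filter_upwards [hf, hg] with x h1 h2 using h1.add h2

lemma SmoothNear.mul {f g : R3 → ℝ} (hf : SmoothNear f) (hg : SmoothNear g) :
    SmoothNear fun x => f x * g x := by
  filter_upwards [hf, hg] with x h1 h2 using h1.mul h2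

lemma smoothNear_coord (i : Fin 3) : SmoothNear fun x => x i :=
  .of_forall fun _ => (contDiff_apply ℝ ℝ i).contDiffAt

lemma smoothNear_const (c : ℝ) : SmoothNear fun _ => c := .of_forall fun _ => contDiffAt_const

lemma SmoothNear.iterate_partialD {f : R3 → ℝ} (hf : SmoothNear f) (i : Fin 3) (n : ℕ) :
    SmoothNear ((Poisson3.partialD i)^[n] f) := by
  induction n with
  | zero => exact hf
  | succ n ih => rw [Function.iterate_succ_apply']; exact ih.partialD i

lemma iterate_partialD_congr {f g : R3 → ℝ} (h : f =ᶠ[𝓝 0] g) (i : Fin 3) (n : ℕ) :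
    (partialD i)^[n] f =ᶠ[𝓝 0] (partialD i)^[n] g := by
  induction n with
  | zero => exact h
  | succ n ih => simp only [Function.iterate_succ_apply']; exact partialD_congr ih i

lemma iterate_partialD_comm {f : R3 → ℝ} (hf : SmoothNear f) (i j : Fin 3) (n : ℕ) :
    (partialD i)^[n] (partialD j f) =ᶠ[𝓝 0] partialD j ((partialD i)^[n] f) := by
  induction n with
  | zero => rfl
  | succ n ih =>
    simp only [Function.iterate_succ_apply']
    refine (partialD_congr ih i).trans ?_
    filter_upwards [hf.iterate_partialD i n] with x hx using partialD_comm hx i j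

open MvPowerSeries

lemma coeff_taylor (f : R3 → ℝ) (n : Fin 3 →₀ ℕ) : coeff n (taylor f) =
    ((partialD 0)^[n 0] ((partialD 1)^[n 1] ((partialD 2)^[n 2] f))) 0
      / ((n 0).factorial * (n 1).factorial * (n 2).factorial : ℝ) := rfl

lemma taylor_congr {f g : R3 → ℝ} (h : f =ᶠ[𝓝 0] g) : taylor f = taylor g := by
  ext n
  rw [coeff_taylor, coeff_taylor, (iterate_partialD_congr (iterate_partialD_congr
    (iterate_partialD_congr h 2 _) 1 _) 0 _).self_of_nhds]

lemma constantCoeff_taylor (f : R3 → ℝ) : constantCoeff (taylor f) = f 0 := by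
  rw [← coeff_zero_eq_constantCoeff_apply, coeff_taylor]
  simp

lemma pderiv_taylor {f : R3 → ℝ} (hf : SmoothNear f) (i : Fin 3) :
    pderiv ℝ i (taylor f) = taylor (partialD i f) := by
  ext n
  rw [coeff_pderiv, coeff_taylor, coeff_taylor]
  have h2 := iterate_partialD_comm hf 2 i (n 2)
  have h1 := iterate_partialD_comm (hf.iterate_partialD 2 (n 2)) 1 i (n 1)
  have h1' := (iterate_partialD_congr h2 1 (n 1)).trans h1
  have h0 := iterate_partialD_comm
    ((hf.iterate_partialD 2 (n 2)).iterate_partialD 1 (n 1)) 0 i (n 0)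
  have h0' := (iterate_partialD_congr h1' 0 (n 0)).trans h0
  have hn : ∀ k : ℕ, (k : ℝ) + 1 ≠ 0 := fun k => by positivity
  fin_cases i
  · rw [← (iterate_partialD_congr h1' 0 (n 0)).self_of_nhds.symm]
    simp only [Fin.zero_eta, Finsupp.add_apply, Finsupp.single_apply]
    simp [Function.iterate_succ_apply, Nat.factorial_succ]
    field_simp [hn]
  · rw [← (iterate_partialD_congr (iterate_partialD_congr h2 1 (n 1)) 0 (n 0)).self_of_nhds.symm]
    simp only [Fin.mk_one, Finsupp.add_apply, Finsupp.single_apply]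
    simp [Function.iterate_succ_apply, Nat.factorial_succ]
    field_simp [hn]
  · simp only [Fin.reduceFinMk, Finsupp.add_apply, Finsupp.single_apply]
    simp [Function.iterate_succ_apply, Nat.factorial_succ]
    field_simp [hn]

lemma taylor_zero : taylor (fun _ => 0) = 0 := by
  have h : ∀ i n, (partialD i)^[n] (fun _ => (0 : ℝ)) = fun _ => 0 := fun i n => by
    induction n with
    | zero => rfl
    | succ n ih => rw [Function.iterate_succ_apply, partialD_const, ih]
  ext n
  rw [coeff_taylor, h, h, h]
  simp

lemma taylor_const (c : ℝ) : taylor (fun _ => c) = C c := by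
  refine pderiv.ext (fun i => ?_) ?_
  · rw [pderiv_taylor (smoothNear_const c), partialD_const, taylor_zero, pderiv_C]
  · rw [constantCoeff_taylor, constantCoeff_C]

lemma taylor_coord (j : Fin 3) : taylor (fun x => x j) = X j := by
  refine pderiv.ext (fun i => ?_) ?_
  · rw [pderiv_taylor (smoothNear_coord j), partialD_coord, taylor_const]
    rcases eq_or_ne j i with rfl | h
    · simp
    · simp [h, pderiv_X_of_ne h]
  · rw [constantCoeff_taylor, constantCoeff_X, Pi.zero_apply]

/-- A series vanishes if it lies in an additive subgroup that is stable under partial derivatives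
and consists of series without constant term. -/
lemma eq_zero_of_mem_of_pderiv_stable (S : AddSubgroup Series3)
    (h0 : ∀ A ∈ S, constantCoeff A = 0) (hS : ∀ A ∈ S, ∀ i, pderiv ℝ i A ∈ S)
    {A : Series3} (hA : A ∈ S) : A = 0 := by
  have key : ∀ n, ∀ A ∈ S, ∀ d : Fin 3 →₀ ℕ, d.degree = n → coeff d A = 0 := by
    intro n
    induction n with
    | zero =>
      intro A hA d hd
      rw [(Finsupp.degree_eq_zero_iff d).1 hd, coeff_zero_eq_constantCoeff_apply, h0 A hA]
    | succ n ih =>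
      intro A hA d hd
      obtain ⟨i, hi⟩ : ∃ i, d i ≠ 0 := by
        by_contra! h
        rw [show d = 0 from Finsupp.ext h] at hd
        simp at hd
      obtain ⟨e, rfl⟩ : ∃ e, d = e + Finsupp.single i 1 :=
        ⟨d - Finsupp.single i 1,
          (tsub_add_cancel_of_le (by simpa [Nat.one_le_iff_ne_zero] using hi)).symm⟩
      have := ih _ (hS A hA i) e (by simpa using hd)
      rw [coeff_pderiv, mul_eq_zero] at this
      exact this.resolve_right (by positivity)
  exact ext fun d => key _ A hA d rfl

lemma taylor_add {f g : R3 → ℝ} (hf : SmoothNear f) (hg : SmoothNear g) :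
    taylor (fun x => f x + g x) = taylor f + taylor g := by
  let T : Set Series3 := {A | ∃ f g, SmoothNear f ∧ SmoothNear g ∧
    A = taylor (fun x => f x + g x) - (taylor f + taylor g)}
  refine sub_eq_zero.1 (eq_zero_of_mem_of_pderiv_stable (AddSubgroup.closure T) ?_ ?_
    (AddSubgroup.subset_closure ⟨f, g, hf, hg, rfl⟩))
  · intro A hA
    induction hA using AddSubgroup.closure_induction with
    | mem A h => obtain ⟨f, g, -, -, rfl⟩ := h; simp [constantCoeff_taylor]
    | zero => simp
    | add A B _ _ h1 h2 => simp [h1, h2]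
    | neg A _ h => simp [h]
  · intro A hA i
    induction hA using AddSubgroup.closure_induction with
    | mem A h =>
      obtain ⟨f, g, hf, hg, rfl⟩ := h
      refine AddSubgroup.subset_closure ⟨_, _, hf.partialD i, hg.partialD i, ?_⟩
      rw [map_sub, map_add, pderiv_taylor hf, pderiv_taylor hg, pderiv_taylor (hf.add hg)]
      congr 1
      refine taylor_congr ?_
      filter_upwards [hf, hg] with x h1 h2 using
        partialD_add (h1.differentiableAt (by simp)) (h2.differentiableAt (by simp)) i
    | zero => simp [zero_mem]
    | add A B _ _ h1 h2 => rw [map_add]; exact add_mem h1 h2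
    | neg A _ h => rw [map_neg]; exact neg_mem h

lemma taylor_mul {f g : R3 → ℝ} (hf : SmoothNear f) (hg : SmoothNear g) :
    taylor (fun x => f x * g x) = taylor f * taylor g := by
  let T : Set Series3 := {A | ∃ f g, SmoothNear f ∧ SmoothNear g ∧
    A = taylor (fun x => f x * g x) - taylor f * taylor g}
  refine sub_eq_zero.1 (eq_zero_of_mem_of_pderiv_stable (AddSubgroup.closure T) ?_ ?_
    (AddSubgroup.subset_closure ⟨f, g, hf, hg, rfl⟩))
  · intro A hA
    induction hA using AddSubgroup.closure_induction with
    | mem A h => obtain ⟨f, g, -, -, rfl⟩ := h; simp [constantCoeff_taylor]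
    | zero => simp
    | add A B _ _ h1 h2 => simp [h1, h2]
    | neg A _ h => simp [h]
  · intro A hA i
    induction hA using AddSubgroup.closure_induction with
    | mem A h =>
      obtain ⟨f, g, hf, hg, rfl⟩ := h
      have h1 : taylor (fun x => f x * partialD i g x) - taylor f * taylor (partialD i g) ∈ T :=
        ⟨_, _, hf, hg.partialD i, rfl⟩
      have h2 : taylor (fun x => g x * partialD i f x) - taylor g * taylor (partialD i f) ∈ T :=
        ⟨_, _, hg, hf.partialD i, rfl⟩
      have h3 : taylor (partialD i fun x => f x * g x) =
          taylor (fun x => f x * partialD i g x) + taylor (fun x => g x * partialD i f x) := by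
        rw [← taylor_add (hf.mul (hg.partialD i)) (hg.mul (hf.partialD i))]
        refine taylor_congr ?_
        filter_upwards [hf, hg] with x h1 h2 using
          partialD_mul (h1.differentiableAt (by simp)) (h2.differentiableAt (by simp)) i
      convert add_mem (AddSubgroup.subset_closure h1) (AddSubgroup.subset_closure h2) using 1
      rw [map_sub, Derivation.leibniz, pderiv_taylor hf, pderiv_taylor hg,
        pderiv_taylor (hf.mul hg), h3, smul_eq_mul, smul_eq_mul]
      ring
    | zero => simp [zero_mem]
    | add A B _ _ h1 h2 => rw [map_add]; exact add_mem h1 h2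
    | neg A _ h => rw [map_neg]; exact neg_mem h

lemma SmoothNear.neg {f : R3 → ℝ} (hf : SmoothNear f) : SmoothNear fun x => -f x :=
  Filter.Eventually.mono hf fun _ h => h.neg

lemma taylor_neg {f : R3 → ℝ} (hf : SmoothNear f) : taylor (fun x => -f x) = -taylor f := by
  rw [eq_neg_iff_add_eq_zero, ← taylor_add hf.neg hf]
  simpa using taylor_zero

end Taylor

section Parameters

variable {l : ℕ}

lemma fderiv_slice {F : Type*} [NormedAddCommGroup F] [NormedSpace ℝ F] {G : Param l → R3 → F}
    {ε : Param l} {x : R3} (hG : DifferentiableAt ℝ (fun p : Param l × R3 => G p.1 p.2) (ε, x))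
    (w : R3) : fderiv ℝ (G ε) x w = fderiv ℝ (fun p : Param l × R3 => G p.1 p.2) (ε, x) (0, w) := by
  have hc : HasFDerivAt (fun x : R3 => (ε, x)) (ContinuousLinearMap.inr ℝ (Param l) R3) x :=
    hasFDerivAt_prodMk_right ε x
  have := (hG.hasFDerivAt.comp x hc).fderiv
  change fderiv ℝ ((fun p : Param l × R3 => G p.1 p.2) ∘ fun x : R3 => (ε, x)) x _ = _
  rw [this]
  simp

lemma contDiffOn_partialD {G : Param l → R3 → ℝ} {O : Set (Param l × R3)} (hO : IsOpen O)
    (hG : ContDiffOn ℝ ∞ (fun p : Param l × R3 => G p.1 p.2) O) (i : Fin 3) :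
    ContDiffOn ℝ ∞ (fun p : Param l × R3 => partialD i (G p.1) p.2) O := by
  have h1 : ContDiffOn ℝ ∞ (fun p => fderiv ℝ (fun p : Param l × R3 => G p.1 p.2) p
      ((0 : Param l), (Pi.single i 1 : R3))) O :=
    (hG.fderiv_of_isOpen hO (m := ∞) (by simp)).clm_apply contDiffOn_const
  refine h1.congr fun p hp => ?_
  exact fderiv_slice ((hG.contDiffAt (hO.mem_nhds hp)).differentiableAt (by simp)) _

lemma contDiffOn_iterate_partialD {G : Param l → R3 → ℝ} {O : Set (Param l × R3)} (hO : IsOpen O)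
    (hG : ContDiffOn ℝ ∞ (fun p : Param l × R3 => G p.1 p.2) O) (i : Fin 3) (n : ℕ) :
    ContDiffOn ℝ ∞ (fun p : Param l × R3 => ((partialD i)^[n] (G p.1)) p.2) O := by
  induction n with
  | zero => exact hG
  | succ n ih =>
    simp only [Function.iterate_succ_apply']
    exact contDiffOn_partialD (G := fun ε => (partialD i)^[n] (G ε)) hO ih i

lemma smoothSeriesOn_taylor {G : Param l → R3 → ℝ} {O : Set (Param l × R3)} (hO : IsOpen O)
    (hG : ContDiffOn ℝ ∞ (fun p : Param l × R3 => G p.1 p.2) O) {W : Set (Param l)}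
    (hW : ∀ ε ∈ W, (ε, (0 : R3)) ∈ O) : SmoothSeriesOn W fun ε => taylor (G ε) := by
  intro n
  simp only [coeff_taylor]
  have h2 := contDiffOn_iterate_partialD hO hG 2 (n 2)
  have h1 := contDiffOn_iterate_partialD (G := fun ε => (partialD 2)^[n 2] (G ε)) hO h2 1 (n 1)
  have h0 := contDiffOn_iterate_partialD
    (G := fun ε => (partialD 1)^[n 1] ((partialD 2)^[n 2] (G ε))) hO h1 0 (n 0)
  have hi : ContDiffOn ℝ ∞ (fun ε : Param l => (ε, (0 : R3))) W :=
    (contDiff_id.prodMk contDiff_const).contDiffOn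
  exact (h0.comp hi hW).div_const _

lemma contDiffAt_slice {F : Type*} [NormedAddCommGroup F] [NormedSpace ℝ F]
    {G : Param l → R3 → F} {O : Set (Param l × R3)} (hO : IsOpen O)
    (hG : ContDiffOn ℝ ∞ (fun p : Param l × R3 => G p.1 p.2) O) {ε : Param l} {x : R3}
    (hx : (ε, x) ∈ O) : ContDiffAt ℝ ∞ (G ε) x :=
  (hG.contDiffAt (hO.mem_nhds hx)).comp x (contDiff_prodMk_right ε).contDiffAt

end Parameters

end Poisson3

/-! ### Formal reduction of smooth families -/

namespace Poisson3

open MvPowerSeries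

lemma bracket_coord_left (π : BivectorField) (i : Fin 3) (g : R3 → ℝ) (x : R3) :
    bracket π (fun y => y i) g x = ∑ j, π x i j * partialD j g x := by
  simp only [bracket, partialD_coord]
  rw [Finset.sum_eq_single i]
  · simp
  · intro b _ hb
    simp [hb.symm]
  · simp

lemma bracket_coord (π : BivectorField) (i j : Fin 3) :
    bracket π (fun y => y i) (fun y => y j) = fun x => π x i j := by
  ext x
  rw [bracket_coord_left]
  simp [partialD_coord]

/-- The Jacobi identity for a 2-vector `{x,y} = z`, `{y,z} = U`, `{z,x} = V`. -/
lemma jacobi_of_isPoissonAt {π : BivectorField} {x : R3} (h : IsPoissonAt π x) {U V : R3 → ℝ}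
    (hπ : ∀ᶠ y in 𝓝 x, π y = skew (y 2) (U y) (V y)) :
    x 2 * partialD 1 U x + U x * partialD 2 V x = x 2 * partialD 0 V x + V x * partialD 2 U x := by
  have hc : ∀ i : Fin 3, ContDiffAt ℝ ∞ (fun y : R3 => y i) x :=
    fun i => (contDiff_apply ℝ ℝ i).contDiffAt
  have hx := hπ.self_of_nhds
  have hJ := h.2 _ _ _ (hc 0) (hc 1) (hc 2)
  have h12 : (fun y => π y 1 2) =ᶠ[𝓝 x] U := hπ.mono fun y hy => by simp [hy, skew]
  have h20 : (fun y => π y 2 0) =ᶠ[𝓝 x] V := hπ.mono fun y hy => by simp [hy, skew]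
  have h01 : (fun y => π y 0 1) =ᶠ[𝓝 x] fun y => y 2 := hπ.mono fun y hy => by simp [hy, skew]
  rw [bracket_coord, bracket_coord, bracket_coord, bracket_coord_left, bracket_coord_left,
    bracket_coord_left] at hJ
  simp only [partialD_congr_self h12, partialD_congr_self h20, partialD_congr_self h01,
    partialD_coord, hx, Fin.sum_univ_three] at hJ
  simp [skew] at hJ
  linarith

/-- Every family in pre-normal form is formally reducible: the Taylor series satisfy the Jacobi
identity, and their coefficients are smooth in the parameter. -/
theorem formallyReducible {l : ℕ} {Q : Family l} (hQ : IsLocalPoissonFamily Q)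
    (hN : HasPreNormalForm Q) : FormallyReducible Q := by
  obtain ⟨O₁, hO₁, h0₁, hsm, hpois⟩ := hQ
  obtain ⟨U₀, V₀, hev⟩ := hN
  obtain ⟨O₂, hO₂sub, hO₂, h0₂⟩ := mem_nhds_iff.1 hev
  let O := O₁ ∩ O₂
  have hO : IsOpen O := hO₁.inter hO₂
  have hcont : ∀ ε : Param l, Continuous fun x : R3 => (ε, x) := fun ε => by fun_prop
  let W : Set (Param l) := (fun ε => (ε, (0 : R3))) ⁻¹' O
  have hsm' : ∀ i j, ContDiffOn ℝ ∞ (fun p : Param l × R3 => Q p.1 p.2 i j) O := fun i j =>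
    (contDiffOn_pi.1 (contDiffOn_pi.1 hsm i) j).mono Set.inter_subset_left
  let U : Param l → R3 → ℝ := fun ε x => Q ε x 1 2
  let V : Param l → R3 → ℝ := fun ε x => Q ε x 2 0
  have hform : ∀ p ∈ O, Q p.1 p.2 = skew (p.2 2) (U p.1 p.2) (V p.1 p.2) := by
    intro p hp
    have h : Q p.1 p.2 = skew (p.2 2) (U₀ p.1 p.2) (V₀ p.1 p.2) := hO₂sub hp.2
    have hU : U p.1 p.2 = U₀ p.1 p.2 := by simp only [U, h]; simp [skew]
    have hV : V p.1 p.2 = V₀ p.1 p.2 := by simp only [V, h]; simp [skew]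
    rw [h, hU, hV]
  have hnear : ∀ ε ∈ W, ∀ᶠ x in 𝓝 (0 : R3), (ε, x) ∈ O := fun ε hε =>
    (hcont ε).continuousAt.eventually_mem (hO.mem_nhds hε)
  have hnear' : ∀ p ∈ O, ∀ᶠ x in 𝓝 p.2, (p.1, x) ∈ O := fun p hp =>
    (hcont p.1).continuousAt.eventually_mem (hO.mem_nhds hp)
  have hUs : ∀ ε ∈ W, SmoothNear (U ε) := fun ε hε =>
    (hnear ε hε).mono fun x hx => contDiffAt_slice (G := U) hO (hsm' 1 2) hx
  have hVs : ∀ ε ∈ W, SmoothNear (V ε) := fun ε hε =>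
    (hnear ε hε).mono fun x hx => contDiffAt_slice (G := V) hO (hsm' 2 0) hx
  have hW : IsOpen W := hO.preimage (by fun_prop)
  obtain ⟨φ, f, g, hφ, hf, hg, h⟩ := exists_formal_reduction (W := W)
    (U := fun ε => taylor (U ε)) (V := fun ε => taylor (V ε))
    (smoothSeriesOn_taylor hO (hsm' 1 2) fun _ h => h)
    (smoothSeriesOn_taylor hO (hsm' 2 0) fun _ h => h) (by
      intro ε hε
      have hz := smoothNear_coord 2
      have hU := hUs ε hε
      have hV := hVs ε hε
      have hJ : taylor (fun x => x 2 * partialD 1 (U ε) x + U ε x * partialD 2 (V ε) x) =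
          taylor (fun x => x 2 * partialD 0 (V ε) x + V ε x * partialD 2 (U ε) x) := by
        refine taylor_congr ((hnear ε hε).mono fun x hx => ?_)
        exact jacobi_of_isPoissonAt (hpois _ hx.1)
          ((hnear' _ hx).mono fun y hy => hform (ε, y) hy)
      rw [taylor_add (hz.mul (hU.partialD 1)) (hU.mul (hV.partialD 2)),
        taylor_add (hz.mul (hV.partialD 0)) (hV.mul (hU.partialD 2)),
        taylor_mul hz (hU.partialD 1), taylor_mul hU (hV.partialD 2),
        taylor_mul hz (hV.partialD 0), taylor_mul hV (hU.partialD 2), taylor_coord,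
        ← pderiv_taylor hU, ← pderiv_taylor hU, ← pderiv_taylor hV, ← pderiv_taylor hV] at hJ
      linear_combination hJ)
  refine ⟨W, hW, ⟨h0₁, h0₂⟩, φ, f, g, hφ, hf, hg, fun ε hε => ?_⟩
  obtain ⟨h1, h2, h3⟩ := h ε hε
  refine ⟨h1, ?_, h3⟩
  have hentry : ∀ (i j : Fin 3) (F : R3 → ℝ),
      (∀ x, skew (x 2) (U ε x) (V ε x) i j = F x) → taylor (fun x => Q ε x i j) = taylor F :=
    fun i j F hF => taylor_congr ((hnear ε hε).mono fun x hx => by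
      simp only [hform (ε, x) hx, hF])
  have hπ : (fun i j => taylor fun x => Q ε x i j) =
      skew (X 2) (taylor (U ε)) (taylor (V ε)) := by
    ext1 i
    ext1 j
    fin_cases i <;> fin_cases j
    · exact (hentry 0 0 _ fun _ => rfl).trans taylor_zero
    · exact (hentry 0 1 _ fun _ => rfl).trans (taylor_coord 2)
    · exact (hentry 0 2 _ fun _ => rfl).trans (taylor_neg (hVs ε hε))
    · exact (hentry 1 0 _ fun _ => rfl).trans
        ((taylor_neg (smoothNear_coord 2)).trans (by rw [taylor_coord]; rfl))
    · exact (hentry 1 1 _ fun _ => rfl).trans taylor_zero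
    · rfl
    · rfl
    · exact (hentry 2 1 _ fun _ => rfl).trans (taylor_neg (hUs ε hε))
    · exact (hentry 2 2 _ fun _ => rfl).trans taylor_zero
  rwa [hπ]

end Poisson3

/-! ### Three-dimensional Lie algebras -/

namespace Poisson3

lemma partialD_linear (i : Fin 3) (w : R3) :
    partialD i (fun x => ∑ k, w k * x k) = fun _ => w i := by
  ext x
  have : (fun x : R3 => ∑ k, w k * x k) =
      (∑ k, w k • ContinuousLinearMap.proj (R := ℝ) (φ := fun _ : Fin 3 => ℝ) k) := by
    ext x
    simp
  rw [partialD, this, ContinuousLinearMap.fderiv]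
  simp [Pi.single_apply]

/-- The bracket of two vectors in the algebra with the structure constants `c`. -/
def structBracket (c : Fin 3 → Fin 3 → Fin 3 → ℝ) (u v : R3) : R3 :=
  fun k => ∑ i, ∑ j, u i * v j * c i j k

/-- If `u, v, [u,v]` are always linearly dependent, the bracket is `[u,v] = α(u) v - α(v) u`. -/
lemma exists_eq_of_forall_det_eq_zero {c : Fin 3 → Fin 3 → Fin 3 → ℝ}
    (hc : ∀ i j k, c i j k = -c j i k)
    (hdet : ∀ u v, Matrix.det (Matrix.of ![u, v, structBracket c u v]) = 0) :
    ∃ α : R3, ∀ i j k,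
      c i j k = α i * (if j = k then 1 else 0) - α j * (if i = k then 1 else 0) := by
  have hd : ∀ i k, c i i k = 0 := fun i k => by have := hc i i k; linarith
  have h10 := hc 1 0
  have h21 := hc 2 1
  have h02 := hc 0 2
  have d1 := hdet ![1, 0, 0] ![0, 1, 0]
  have d2 := hdet ![0, 1, 0] ![0, 0, 1]
  have d3 := hdet ![0, 0, 1] ![1, 0, 0]
  have d4 := hdet ![1, 0, 0] ![0, 1, 1]
  have d5 := hdet ![0, 1, 0] ![1, 0, 1]
  have d6 := hdet ![0, 0, 1] ![1, 1, 0]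
  simp [Matrix.det_fin_three, structBracket, Fin.sum_univ_three, h10, h21, h02] at d1 d2 d3 d4 d5 d6
  refine ⟨![c 0 1 1, -c 0 1 0, c 2 0 0], fun i j k => ?_⟩
  fin_cases i <;> fin_cases j <;> fin_cases k <;> simp [hd, h10, h21, h02] <;> linarith

/-- The structure `{x_i, x_j} = α_i x_j - α_j x_i`, with `α ≠ 0`, is isomorphic to the exceptional
structure. -/
lemma linearlyIsomorphic_exceptional {π : BivectorField} {α : R3} (hα : α ≠ 0)
    (hπ : ∀ x i j, π x i j = α i * x j - α j * x i) : LinearlyIsomorphic π exceptional := by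
  -- new coordinates: two independent ones in the kernel of `α`, and one on which `α` is `-1`
  obtain ⟨M, hM, h0, h1, h2⟩ : ∃ M : Matrix (Fin 3) (Fin 3) ℝ, M.det ≠ 0 ∧
      ∑ k, M 0 k * α k = 0 ∧ ∑ k, M 1 k * α k = 0 ∧ ∑ k, M 2 k * α k = -1 := by
    obtain ⟨k, hk⟩ := Function.ne_iff.1 hα
    simp only [Fin.sum_univ_three, Matrix.det_fin_three]
    fin_cases k
    · refine ⟨!![-α 1, α 0, 0; -α 2, 0, α 0; -(α 0)⁻¹, 0, 0], ?_, ?_, ?_, ?_⟩ <;>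
        simp at hk ⊢ <;>
        first | exact hk | exact mul_inv_cancel₀ hk | exact inv_mul_cancel₀ hk | ring
    · refine ⟨!![α 1, -α 0, 0; 0, -α 2, α 1; 0, -(α 1)⁻¹, 0], ?_, ?_, ?_, ?_⟩ <;>
        simp at hk ⊢ <;>
        first | exact hk | exact mul_inv_cancel₀ hk | exact inv_mul_cancel₀ hk | ring
    · refine ⟨!![α 2, 0, -α 0; 0, α 2, -α 1; 0, 0, -(α 2)⁻¹], ?_, ?_, ?_, ?_⟩ <;>
        simp at hk ⊢ <;>
        first | exact hk | exact mul_inv_cancel₀ hk | exact inv_mul_cancel₀ hk | ring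
  let A : R3 ≃ₗ[ℝ] R3 := LinearMap.equivOfDetNeZero (Matrix.toLin' M)
    (by rwa [LinearMap.det_toLin'])
  have hA : ∀ x i, A x i = ∑ k, M i k * x k := fun x i => by
    change Matrix.toLin' M x i = _
    simp [Matrix.toLin'_apply, Matrix.mulVec, dotProduct]
  refine ⟨A, fun x i j => ?_⟩
  have key : bracket π (fun y => A y i) (fun y => A y j) x =
      (∑ k, M i k * α k) * A x j - (∑ k, M j k * α k) * A x i := by
    simp only [bracket, hA, partialD_linear, hπ]
    simp only [Fin.sum_univ_three]
    ring
  rw [key]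
  fin_cases i <;> fin_cases j <;> simp [h0, h1, h2, exceptional, skew]

/-- A skew algebra that is neither zero nor exceptional contains `u, v` such that `u, v, [u,v]` is
a basis. -/
lemma exists_det_ne_zero {π : BivectorField} {c : Fin 3 → Fin 3 → Fin 3 → ℝ}
    (hc : ∀ i j k, c i j k = -c j i k) (hπ : ∀ x i j, π x i j = ∑ k, c i j k * x k)
    (h0 : π ≠ 0) (hexc : ¬ LinearlyIsomorphic π exceptional) :
    ∃ u v, Matrix.det (Matrix.of ![u, v, structBracket c u v]) ≠ 0 := by
  by_contra! hdet
  obtain ⟨α, hα⟩ := exists_eq_of_forall_det_eq_zero hc hdet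
  have hπα : ∀ x i j, π x i j = α i * x j - α j * x i := fun x i j => by
    simp [hπ, hα, sub_mul, Finset.sum_sub_distrib]
  refine hexc (linearlyIsomorphic_exceptional (fun h => h0 ?_) hπα)
  ext x i j
  simp [hπα, h]

end Poisson3

/-! ### Transport of Poisson structures by local diffeomorphisms -/

namespace Poisson3

lemma fderiv_eq_sum_partialD {f : R3 → ℝ} {x : R3} (w : R3) :
    fderiv ℝ f x w = ∑ k, partialD k f x * w k := by
  conv_lhs => rw [pi_eq_sum_univ' w]
  rw [map_sum]
  refine Finset.sum_congr rfl fun k _ => ?_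
  rw [map_smul, smul_eq_mul, mul_comm, partialD]

lemma partialD_comp {φ : R3 → R3} {f : R3 → ℝ} {x : R3} (hf : DifferentiableAt ℝ f (φ x))
    (hφ : DifferentiableAt ℝ φ x) (i : Fin 3) :
    partialD i (fun y => f (φ y)) x =
      ∑ k, partialD k f (φ x) * partialD i (fun y => φ y k) x := by
  have h1 : fderiv ℝ (fun y => f (φ y)) x = (fderiv ℝ f (φ x)).comp (fderiv ℝ φ x) :=
    fderiv_comp x hf hφ
  have h2 : ∀ k, partialD i (fun y => φ y k) x = fderiv ℝ φ x (Pi.single i 1) k := fun k => by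
    rw [partialD, fderiv_apply hφ k]
    rfl
  rw [partialD, h1, ContinuousLinearMap.comp_apply]
  rw [fderiv_eq_sum_partialD]
  exact Finset.sum_congr rfl fun k _ => by rw [h2]

lemma bracket_comp {φ : R3 → R3} {π π' : BivectorField} {f g : R3 → ℝ} {x : R3}
    (hf : DifferentiableAt ℝ f (φ x)) (hg : DifferentiableAt ℝ g (φ x))
    (hφ : DifferentiableAt ℝ φ x) (hs : SendsAt φ π π' x) :
    bracket π (fun y => f (φ y)) (fun y => g (φ y)) x = bracket π' f g (φ x) := by
  simp only [bracket, ← hs _ _, partialD_comp hf hφ, partialD_comp hg hφ, Fin.sum_univ_three]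
  ring

lemma contDiffAt_bracket {π : BivectorField} {f g : R3 → ℝ} {x : R3} (hπ : ContDiffAt ℝ ∞ π x)
    (hf : ContDiffAt ℝ ∞ f x) (hg : ContDiffAt ℝ ∞ g x) : ContDiffAt ℝ ∞ (bracket π f g) x :=
  ContDiffAt.sum fun i _ => ContDiffAt.sum fun j _ =>
    ((contDiffAt_pi.1 (contDiffAt_pi.1 hπ i) j).mul (contDiffAt_partialD hf i)).mul
      (contDiffAt_partialD hg j)

lemma bracket_congr_right {π : BivectorField} {f g g' : R3 → ℝ} {x : R3} (h : g =ᶠ[𝓝 x] g') :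
    bracket π f g x = bracket π f g' x := by
  simp only [bracket, partialD_congr_self h]

lemma bracket_swap {π : BivectorField} {x : R3} (h : ∀ i j, π x i j = -π x j i) (f g : R3 → ℝ) :
    bracket π f g x = -bracket π g f x := by
  simp only [bracket, Fin.sum_univ_three]
  rw [h 1 0, h 2 0, h 2 1, show π x 0 0 = 0 by linarith [h 0 0],
    show π x 1 1 = 0 by linarith [h 1 1], show π x 2 2 = 0 by linarith [h 2 2]]
  ring

lemma differentiableAt_of_contDiffAt {f : R3 → ℝ} {x : R3} (hf : ContDiffAt ℝ ∞ f x) :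
    ∀ᶠ y in 𝓝 x, DifferentiableAt ℝ f y :=
  ((hf.of_le (m := 1) (by exact_mod_cast le_top)).eventually (by simp)).mono fun _ h =>
    h.differentiableAt (by simp)

/-- The image of a Poisson structure under a smooth map is a Poisson structure. -/
lemma isPoissonAt_of_sendsAt {φ : R3 → R3} {π π' : BivectorField} {x : R3}
    (hφ : ContDiffAt ℝ ∞ φ x) (hπ' : ContDiffAt ℝ ∞ π' (φ x))
    (hs : ∀ᶠ y in 𝓝 x, SendsAt φ π π' y) (hπ : IsPoissonAt π x) : IsPoissonAt π' (φ x) := by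
  refine ⟨fun i j => ?_, fun f g h hf hg hh => ?_⟩
  · rw [← hs.self_of_nhds, ← hs.self_of_nhds, bracket_swap hπ.1]
  have hφd : ∀ᶠ y in 𝓝 x, DifferentiableAt ℝ φ y :=
    ((hφ.of_le (m := 1) (by exact_mod_cast le_top)).eventually (by simp)).mono fun _ h =>
      h.differentiableAt (by simp)
  have key : ∀ {a b c : R3 → ℝ}, ContDiffAt ℝ ∞ a (φ x) → ContDiffAt ℝ ∞ b (φ x) →
      ContDiffAt ℝ ∞ c (φ x) → bracket π' a (bracket π' b c) (φ x) =
        bracket π (fun y => a (φ y)) (bracket π (fun y => b (φ y)) fun y => c (φ y)) x := by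
    intro a b c ha hb hc
    rw [← bracket_comp (π := π) (ha.differentiableAt (by simp))
      ((contDiffAt_bracket hπ' hb hc).differentiableAt (by simp)) hφd.self_of_nhds hs.self_of_nhds]
    refine bracket_congr_right ?_
    filter_upwards [hs, hφd, hφ.continuousAt.eventually (differentiableAt_of_contDiffAt hb),
      hφ.continuousAt.eventually (differentiableAt_of_contDiffAt hc)] with y h1 h2 h3 h4
      using (bracket_comp h3 h4 h2 h1).symm
  rw [key hf hg hh, key hg hh hf, key hh hf hg]
  exact hπ.2 _ _ _ (hf.comp x hφ) (hg.comp x hφ) (hh.comp x hφ)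

/-- The inverse function theorem, for smooth maps and with a smooth inverse on the whole target. -/
lemma exists_openPartialHomeomorph {E : Type*} [NormedAddCommGroup E] [NormedSpace ℝ E]
    [CompleteSpace E] {Φ : E → E} {O : Set E} (hO : IsOpen O) (hΦ : ContDiffOn ℝ ∞ Φ O) {a : E}
    (ha : a ∈ O) {D : E ≃L[ℝ] E} (hD : HasFDerivAt Φ (D : E →L[ℝ] E) a) :
    ∃ e : OpenPartialHomeomorph E E, a ∈ e.source ∧ e.source ⊆ O ∧ (∀ x, e x = Φ x) ∧
      ContDiffOn ℝ ∞ e.symm e.target := by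
  let e₀ := (hΦ.contDiffAt (hO.mem_nhds ha)).toOpenPartialHomeomorph Φ hD (by simp)
  let s : Set E := O ∩ fderiv ℝ Φ ⁻¹' Set.range ((↑) : (E ≃L[ℝ] E) → E →L[ℝ] E)
  have hs : IsOpen s :=
    (hΦ.continuousOn_fderiv_of_isOpen hO (by simp)).isOpen_inter_preimage hO
      ContinuousLinearEquiv.isOpen
  have he₀ : ∀ x, e₀ x = Φ x := fun _ => rfl
  let e := e₀.restrOpen s hs
  have hsource : e.source ⊆ s := fun x hx => hx.2
  refine ⟨e, ⟨ContDiffAt.mem_toOpenPartialHomeomorph_source _ hD _, ha, D, hD.fderiv.symm⟩,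
    fun x hx => (hsource hx).1, fun x => rfl, fun y hy => ContDiffAt.contDiffWithinAt ?_⟩
  obtain ⟨hyO, D', hD'⟩ := hsource (e.map_target hy)
  have hc : ContDiffAt ℝ ∞ Φ (e.symm y) := hΦ.contDiffAt (hO.mem_nhds hyO)
  refine e.contDiffAt_symm (f₀' := D') hy ?_ hc
  rw [hD']
  exact (hc.differentiableAt (by simp)).hasFDerivAt

end Poisson3

/-! ### The pre-normal form -/

namespace Poisson3

variable {l : ℕ}

/-- The map `x ↦ (u, v, {u, v}_ε)`, for linear functions `u` and `v`. -/
def bracketCoord (P : Family l) (u v : R3) (ε : Param l) (x : R3) : R3 :=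
  ![∑ i, u i * x i, ∑ i, v i * x i, ∑ i, ∑ j, u i * v j * P ε x i j]

lemma bracket_bracketCoord (P : Family l) (u v : R3) (ε : Param l) (x : R3) :
    bracket (P ε) (fun y => bracketCoord P u v ε y 0) (fun y => bracketCoord P u v ε y 1) x =
      bracketCoord P u v ε x 2 := by
  simp only [bracketCoord, bracket, Matrix.cons_val_zero, Matrix.cons_val_one, Matrix.cons_val,
    partialD_linear]
  exact Finset.sum_congr rfl fun i _ => Finset.sum_congr rfl fun j _ => by ring

lemma contDiffOn_bracketCoord {P : Family l} {O : Set (Param l × R3)}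
    (hP : ContDiffOn ℝ ∞ (fun p : Param l × R3 => P p.1 p.2) O) (u v : R3) :
    ContDiffOn ℝ ∞ (fun p : Param l × R3 => bracketCoord P u v p.1 p.2) O := by
  have hx : ∀ i, ContDiffOn ℝ ∞ (fun p : Param l × R3 => p.2 i) O := fun i =>
    ((contDiff_apply ℝ ℝ i).comp contDiff_snd).contDiffOn
  have hlin : ∀ w : R3, ContDiffOn ℝ ∞ (fun p : Param l × R3 => ∑ i, w i * p.2 i) O := fun w =>
    ContDiffOn.sum fun i _ => contDiffOn_const.mul (hx i)
  have hquad : ContDiffOn ℝ ∞ (fun p : Param l × R3 => ∑ i, ∑ j, u i * v j * P p.1 p.2 i j) O :=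
    ContDiffOn.sum fun i _ => ContDiffOn.sum fun j _ =>
      contDiffOn_const.mul (contDiffOn_pi.1 (contDiffOn_pi.1 hP i) j)
  refine contDiffOn_pi.2 fun k => ?_
  fin_cases k
  · exact hlin u
  · exact hlin v
  · exact hquad

/-- At the origin, the new coordinates have the differentials `u, v, [u,v]`. -/
lemma fderiv_bracketCoord {P : Family l} (hP : ContDiffAt ℝ ∞ (P 0) 0) (u v : R3) (w : R3) :
    fderiv ℝ (bracketCoord P u v 0) 0 w = (Matrix.of ![u, v,
      structBracket (fun i j k => partialD k (fun x => P 0 x i j) 0) u v]).mulVec w := by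
  have hPd : ∀ i j, DifferentiableAt ℝ (fun x => P 0 x i j) 0 := fun i j =>
    (contDiffAt_pi.1 (contDiffAt_pi.1 hP i) j).differentiableAt (by simp)
  have hlin : ∀ u : R3, DifferentiableAt ℝ (fun x : R3 => ∑ i, u i * x i) 0 := fun u => by fun_prop
  have hquad : DifferentiableAt ℝ (fun x : R3 => ∑ i, ∑ j, u i * v j * P 0 x i j) 0 :=
    DifferentiableAt.fun_sum fun i _ => DifferentiableAt.fun_sum fun j _ =>
      (hPd i j).const_mul _
  have hd : DifferentiableAt ℝ (bracketCoord P u v 0) 0 := by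
    refine differentiableAt_pi.2 fun k => ?_
    fin_cases k
    · exact hlin u
    · exact hlin v
    · exact hquad
  have hpart : ∀ k, partialD k (fun x : R3 => ∑ i, ∑ j, u i * v j * P 0 x i j) 0 =
      structBracket (fun i j k => partialD k (fun x => P 0 x i j) 0) u v k := by
    intro k
    rw [partialD, fderiv_fun_sum fun i _ => DifferentiableAt.fun_sum fun j _ =>
      (hPd i j).const_mul _]
    simp only [sum_apply, structBracket]
    refine Finset.sum_congr rfl fun i _ => ?_
    rw [fderiv_fun_sum fun j _ => (hPd i j).const_mul _]
    simp only [sum_apply]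
    refine Finset.sum_congr rfl fun j _ => ?_
    rw [fderiv_const_mul (hPd i j)]
    rfl
  ext k
  have h := congrArg (fun L => L w) (fderiv_apply hd k)
  simp only [ContinuousLinearMap.comp_apply, ContinuousLinearMap.proj_apply] at h
  rw [← h, fderiv_eq_sum_partialD]
  simp only [Matrix.mulVec, dotProduct, Matrix.of_apply]
  fin_cases k
  · exact Finset.sum_congr rfl fun i _ => by
      change partialD i (fun x : R3 => ∑ i, u i * x i) 0 * _ = _
      rw [partialD_linear]; rfl
  · exact Finset.sum_congr rfl fun i _ => by
      change partialD i (fun x : R3 => ∑ i, v i * x i) 0 * _ = _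
      rw [partialD_linear]; rfl
  · exact Finset.sum_congr rfl fun i _ => by
      change partialD i (fun x : R3 => ∑ i, ∑ j, u i * v j * P 0 x i j) 0 * _ = _
      rw [hpart]; rfl

lemma oneJet_apply {π : BivectorField} (hπ : DifferentiableAt ℝ π 0) (h0 : π 0 = 0) (x : R3)
    (i j : Fin 3) : oneJet π x i j = ∑ k, partialD k (fun y => π y i j) 0 * x k := by
  have h1 : ∀ i, DifferentiableAt ℝ (fun y => π y i) 0 := differentiableAt_pi.1 hπ
  rw [← fderiv_eq_sum_partialD, fderiv_apply (h1 i) j, fderiv_apply hπ i]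
  simp [oneJet, h0]

/-- Reduction to the pre-normal form: `(ε, x) ↦ (ε, u, v, {u,v}_ε)` is a local diffeomorphism, and
the family is transported along it. -/
theorem exists_preNormalForm {P : Family l} (hP : IsLocalPoissonFamily P) (h_zero : P 0 0 = 0)
    (h_jet : oneJet (P 0) ≠ 0) (h_exc : ¬ LinearlyIsomorphic (oneJet (P 0)) exceptional) :
    ∃ Q : Family l, IsLocalPoissonFamily Q ∧ FamilyEquiv P Q ∧ HasPreNormalForm Q := by
  obtain ⟨O, hO, h0, hsm, hpois⟩ := hP
  have hsm' : ∀ i j, ContDiffOn ℝ ∞ (fun p : Param l × R3 => P p.1 p.2 i j) O := fun i j =>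
    contDiffOn_pi.1 (contDiffOn_pi.1 hsm i) j
  have hP0 : ContDiffAt ℝ ∞ (P 0) 0 := contDiffAt_slice hO hsm h0
  -- the linear part has a basis of the form `u, v, [u,v]`
  obtain ⟨u, v, huv⟩ := exists_det_ne_zero
    (c := fun i j k => partialD k (fun x => P 0 x i j) 0) (by
      intro i j k
      have hev : (fun x => P 0 x i j) =ᶠ[𝓝 0] fun x => -P 0 x j i := by
        have hc : Continuous fun x : R3 => ((0 : Param l), x) := by fun_prop
        filter_upwards [hc.continuousAt.eventually_mem (hO.mem_nhds h0)] with x hx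
          using (hpois _ hx).1 i j
      change partialD k (fun x => P 0 x i j) 0 = -partialD k (fun x => P 0 x j i) 0
      rw [partialD_congr_self hev]
      simp [partialD])
    (oneJet_apply (hP0.differentiableAt (by simp)) h_zero) h_jet h_exc
  set φ := bracketCoord P u v with hφ
  let Φ : Param l × R3 → Param l × R3 := fun p => (p.1, φ p.1 p.2)
  have hφO : ContDiffOn ℝ ∞ (fun p : Param l × R3 => φ p.1 p.2) O := contDiffOn_bracketCoord hsm u v
  have hΦO : ContDiffOn ℝ ∞ Φ O := contDiff_fst.contDiffOn.prodMk hφO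
  have hφd : DifferentiableAt ℝ (fun p : Param l × R3 => φ p.1 p.2) (0, 0) :=
    (hφO.contDiffAt (hO.mem_nhds h0)).differentiableAt (by simp)
  have hΦ' : HasFDerivAt Φ ((ContinuousLinearMap.fst ℝ (Param l) R3).prod
      (fderiv ℝ (fun p : Param l × R3 => φ p.1 p.2) (0, 0))) (0, 0) :=
    hasFDerivAt_fst.prodMk hφd.hasFDerivAt
  set D₀ := (ContinuousLinearMap.fst ℝ (Param l) R3).prod
      (fderiv ℝ (fun p : Param l × R3 => φ p.1 p.2) (0, 0))
  have hinj : Function.Injective (D₀ : Param l × R3 →ₗ[ℝ] Param l × R3) := by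
    rw [injective_iff_map_eq_zero]
    rintro ⟨δ, w⟩ h
    have h1 : δ = 0 := congrArg Prod.fst h
    subst h1
    have h2 : fderiv ℝ (fun p : Param l × R3 => φ p.1 p.2) (0, 0) (0, w) = 0 := congrArg Prod.snd h
    rw [← fderiv_slice hφd, fderiv_bracketCoord hP0] at h2
    rw [Matrix.eq_zero_of_mulVec_eq_zero huv h2]
    rfl
  let D : (Param l × R3) ≃L[ℝ] (Param l × R3) :=
    (LinearEquiv.ofInjectiveEndo (D₀ : Param l × R3 →ₗ[ℝ] Param l × R3)
      hinj).toContinuousLinearEquiv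
  have hD : (D : Param l × R3 →L[ℝ] Param l × R3) = D₀ := by
    ext x <;> rfl
  obtain ⟨e, he0, heO, heΦ, hesymm⟩ := exists_openPartialHomeomorph hO hΦO h0 (D := D)
    (by rwa [hD])
  have hright : ∀ q ∈ e.target, Φ (e.symm q) = q := fun q hq => by rw [← heΦ, e.right_inv hq]
  have hfst : ∀ q ∈ e.target, (e.symm q).1 = q.1 := fun q hq => by
    have h : (Φ (e.symm q)).1 = q.1 := by rw [hright q hq]
    exact h
  have hsnd : ∀ q ∈ e.target, φ q.1 (e.symm q).2 = q.2 := fun q hq => by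
    have h : (Φ (e.symm q)).2 = q.2 := by rw [hright q hq]
    rwa [← hfst q hq]
  have hmem : ∀ q ∈ e.target, (q.1, (e.symm q).2) ∈ e.source := fun q hq => by
    rw [← hfst q hq]
    exact e.map_target hq
  let Q : Family l := fun ε y i j =>
    bracket (P ε) (fun x => φ ε x i) (fun x => φ ε x j) (e.symm (ε, y)).2
  have hsends : ∀ p ∈ e.source, SendsAt (φ p.1) (P p.1) (Q p.1) p.2 := by
    intro p hp i j
    have : e.symm (p.1, φ p.1 p.2) = p := by
      rw [show (p.1, φ p.1 p.2) = e p from (heΦ p).symm, e.left_inv hp]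
    simp only [Q, this]
  have h0target : ((0 : Param l), (0 : R3)) ∈ e.target := by
    have h := e.map_source he0
    rw [heΦ] at h
    convert h using 1
    ext k
    · rfl
    · fin_cases k <;> simp [Φ, hφ, bracketCoord, h_zero]
  have hQsm : ContDiffOn ℝ ∞ (fun p : Param l × R3 => Q p.1 p.2) e.target := by
    have hB : ∀ i j, ContDiffOn ℝ ∞ (fun p : Param l × R3 =>
        bracket (P p.1) (fun x => φ p.1 x i) (fun x => φ p.1 x j) p.2) O := by
      intro i j
      have hφi := fun i a => contDiffOn_partialD (G := fun ε x => φ ε x i) hO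
        (contDiffOn_pi.1 hφO i) a
      exact ContDiffOn.sum fun a _ => ContDiffOn.sum fun b _ =>
        ((hsm' a b).mul (hφi i a)).mul (hφi j b)
    refine contDiffOn_pi.2 fun i => contDiffOn_pi.2 fun j => ?_
    refine ((hB i j).comp hesymm fun q hq => heO (e.map_target hq)).congr fun q hq => ?_
    simp only [Function.comp_apply, hfst q hq]
    rfl
  have hQpois : ∀ q ∈ e.target, IsPoissonAt (Q q.1) q.2 := by
    intro q hq
    have hp := hmem q hq
    have hc : Continuous fun x : R3 => (q.1, x) := by fun_prop
    have h := isPoissonAt_of_sendsAt (φ := φ q.1) (π := P q.1) (π' := Q q.1)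
      (x := (e.symm q).2) (contDiffAt_slice hO hφO (heO hp))
      (by
        rw [hsnd q hq]
        exact contDiffAt_slice e.open_target hQsm hq)
      ((hc.continuousAt.eventually_mem (e.open_source.mem_nhds hp)).mono fun x hx =>
        hsends (q.1, x) hx)
      (hpois _ (heO hp))
    rwa [hsnd q hq] at h
  refine ⟨Q, ⟨e.target, e.open_target, h0target, hQsm, hQpois⟩, ⟨φ, ?_, ?_, ?_⟩,
    fun ε y => Q ε y 1 2, fun ε y => Q ε y 2 0, ?_⟩
  · ext k
    fin_cases k <;> simp [hφ, bracketCoord, h_zero]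
  · refine ⟨⟨e.toPartialEquiv, e.open_source, e.open_target, ?_, ?_⟩, he0, fun p _ => (heΦ p).symm⟩
    · exact contMDiffOn_iff_contDiffOn.2 ((hΦO.mono heO).congr fun p _ => heΦ p)
    · exact contMDiffOn_iff_contDiffOn.2 hesymm
  · exact Filter.eventually_of_mem (e.open_source.mem_nhds he0) hsends
  · refine Filter.eventually_of_mem (e.open_target.mem_nhds h0target) fun q hq => ?_
    have h01 : Q q.1 q.2 0 1 = q.2 2 := by
      simp only [Q, hφ, bracket_bracketCoord]
      exact congrFun (hsnd q hq) 2
    have hskew := (hQpois q hq).1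
    have hdiag : ∀ i, Q q.1 q.2 i i = 0 := fun i => by linarith [hskew i i]
    ext i j
    fin_cases i <;> fin_cases j <;> simp [skew, hdiag, h01]
    · exact hskew 0 2
    · rw [hskew 1 0, h01]
    · exact hskew 2 1

end Poisson3

theorem theorem1p1 (l : ℕ) (P : Poisson3.Family l)
    (hP : Poisson3.IsLocalPoissonFamily P)
    (h_zero : P 0 0 = 0)
    (h_jet : Poisson3.oneJet (P 0) ≠ 0)
    (h_exc : ¬ Poisson3.LinearlyIsomorphic (Poisson3.oneJet (P 0)) Poisson3.exceptional) :
    (∃ Q : Poisson3.Family l, Poisson3.IsLocalPoissonFamily Q ∧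
      Poisson3.FamilyEquiv P Q ∧ Poisson3.HasPreNormalForm Q) ∧
    (∀ Q : Poisson3.Family l, Poisson3.IsLocalPoissonFamily Q →
      Poisson3.FamilyEquiv P Q → Poisson3.HasPreNormalForm Q →
      Poisson3.FormallyReducible Q) :=
  ⟨Poisson3.exists_preNormalForm hP h_zero h_jet h_exc,
    fun _ hQ _ hN => Poisson3.formallyReducible hQ hN⟩
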